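/- **Definitions.** Let $\mathbb K=\mathbb R$ or $\mathbb C$. A *Saks space* $(X,\|\cdot\|_X,\tau_X)$ is a Banach space $(X,\|\cdot\|_X)$ over $\mathbb K$ with a Hausdorff locally convex topology $\tau_X$ that is coarser than the norm topology and such that $(X,\tau_X)'$ is norming for $X$, i.e. $\|x\|_X=\sup\{|x'(x)| : x'\in (X,\tau_X)',\ \|x'\|\le 1\}$ for all $x \in X$. Its *mixed topology* $\gamma_X$ is the finest linear topology on $X$ which coincides with $\tau_X$ on $\|\cdot\|_X$-bounded sets and lies between $\tau_X$ and the norm topology. The Saks space is *sequentially complete* if every $\gamma_X$-Cauchy sequence is $\gamma_X$-convergent, and *C-sequential* if every convex sequentially open subset of $(X,\gamma_X)$ is open in $(X,\gamma_X)$. Let $X^\circ$ be the space of all $x'\in X'$ (the norm dual) which are sequentially $\tau_X$-continuous on $\|\cdot\|_X$-bounded sets, with the norm of $X'$. A semigroup $(S_t)_{t\ge 0}$ in $\mathcal L(X)$ is *locally $\tau_X$-bi-continuous* if (i) there are $M\ge1$, $\omega\in\mathbb R$ with $\|S_t\|\le Me^{\omega t}$ for all $t\ge0$; (ii) $t\mapsto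 S_tx$ is $\tau_X$-continuous on $[0,\infty)$ for every $x\in X$; (iii) for every $\|\cdot\|_X$-bounded sequence $(x_n)$ in $X$ with $\tau_X$-limit $x \in X$ one has $\tau_X$-$\lim_n S_t(x_n-x)=0$ uniformly for $t$ in compact subsets of $[0,\infty)$. **Setting.** Let $(X,\|\cdot\|_X,\tau_X)$ be a sequentially complete C-sequential Saks space, $(U,\|\cdot\|_U,\tau_U)$ a Saks space over the same field, $(S_t)_{t\ge0}$ a locally $\tau_X$-bi-continuous semigroup on $X$ with generator $-A$, $B\in\mathcal L(U;X)$ such that $B$ is also $\tau_U$-$\tau_X$-continuous on $\|\cdot\|_U$-bounded sets, and $T>0$. Put $S_t^\circ x^\circ := x^\circ\circ S_t$ and $B^\circ x^\circ := x^\circ\circ B$ for $x^\circ\in X^\circ$. Let $C_{\tau,b}([0,T];U)$ be the space of $\tau_U$-continuous functions $u:[0,T]\to U$ with $\|u\|_\infty:=\sup_{t\in[0,T]}\|u(t)\|_U<\infty$, and let $\gamma_\infty$ be the locally convex topology on it given by the seminorms $u\mapsto\sup_{t\in[0,T]}p(u(t))$, where $p$ runs through the $\gamma_U$-continuous seminorms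 on $U$. The dual $(C_{\tau,b}([0,T];U),\gamma_\infty)'$ carries the norm $\|y'\|=\sup\{|y'(u)| : \|u\|_\infty\le1\}$. Set $$\mathcal B^Tu:=\int_0^TS_{T-t}Bu(t)\,dt ,\qquad (\mathcal B^T)^\circ x^\circ:=x^\circ\circ\mathcal B^T\quad(x^\circ\in X^\circ),$$ with a $\tau_X$-Pettis integral, i.e. $x'(\mathcal B^Tu)=\int_0^Tx'(S_{T-t}Bu(t))\,dt$ for all $x'\in(X,\tau_X)'$. For $u\in C_{\tau,b}([0,T];U)$ and $x_0\in X$, the mild solution of $\dot x=-Ax+Bu$, $x(0)=x_0$, is $x(t)=S_tx_0+\int_0^tS_{t-r}Bu(r)\,dr$ for $t\in[0,T]$; so $x(T)=S_Tx_0+\mathcal B^Tu$. **Theorem.** In this setting, the integral $\mathcal B^Tu$ exists for every $u\in C_{\tau,b}([0,T];U)$, one has $(\mathcal B^T)^\circ x^\circ\in (C_{\tau,b}([0,T];U),\gamma_\infty)'$ for every $x^\circ\in X^\circ$, and the following assertions are equivalent: (a) The system $\dot x=-Ax+Bu$, $x(0)=x_0$, is cost-uniformly approximately $\tau_X$-null-controllable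 in time $T$ via $C_{\tau,b}([0,T];U)$: there is $C\ge0$ such that for all $x_0\in X$, $\varepsilon>0$ and every $\tau_X$-continuous seminorm $p$ on $X$ there is $u\in C_{\tau,b}([0,T];U)$ with $\|u\|_\infty\le C\|x_0\|_X$ and $p(x(T))\le\varepsilon$. (b) The dual system $\dot x=-A^\circ x$, $y=B^\circ x$ satisfies a final state observability estimate in $(C_{\tau,b}([0,T];U),\gamma_\infty)'$: there is $C_{\mathrm{obs}}\ge0$ such that for all $x^\circ\in X^\circ$ $$\|S_T^\circ x^\circ\|_{X^\circ}\le C_{\mathrm{obs}}\,\|(\mathcal B^T)^\circ x^\circ\|_{(C_{\tau,b}([0,T];U),\gamma_\infty)'} .$$ If in addition $\tau_U$ is the norm topology of $U$, then each of (a) and (b) is equivalent to: (c) There is $C_{\mathrm{obs}}\ge0$ such that for all $x^\circ\in X^\circ$ $$\|S_T^\circ x^\circ\|_{X^\circ}\le C_{\mathrm{obs}}\,\|B^\circ S_{(\cdot)}^\circ x^\circ\odot\lambda\|_{var},$$ where $(B^\circ S^\circ_{(\cdot)}x^\circ\odot\lambda)(N)u:=\int_N\langle B^\circ S_t^\circ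 x^\circ,u\rangle\,dt$ for Borel sets $N\subseteq[0,T]$ and $u\in U$, and $\|\nu\|_{var}:=\sup\bigl|\sum_{i=1}^n\nu(N_i)u_i\bigr|$, the supremum being taken over all finite partitions $(N_i)_{i=1}^n$ of $[0,T]$ into disjoint Borel sets and all $u_1,\dots,u_n\in U$ with $\|u_i\|_U\le1$. -/

import Mathlib

open Set Filter Topology MeasureTheory
open scoped NNReal ENNReal

noncomputable section

namespace SaksControl

/-! ### Saks spaces and the mixed topology

A normed space `X` carries its norm topology as an instance; the second, coarser topology `τ` and
the mixed topology `γ` are never instances and are always passed explicitly. In Mathlib's order on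
topologies, `t ≤ t'` means that `t` is finer than `t'`. -/

/-- The norm topology. -/
abbrev normTopology (X : Type*) [NormedAddCommGroup X] : TopologicalSpace X := inferInstance

/-- A Saks space `(X, ‖·‖, τ)`: `X` is a Banach space, `τ` is a Hausdorff locally convex topology
coarser than the norm topology, and `(X, τ)'` is norming for `X`. -/
structure SaksSpace (𝕜 X : Type*) [RCLike 𝕜] [NormedAddCommGroup X] [NormedSpace 𝕜 X]
    [Module ℝ X] where
  /-- The second topology `τ` on `X`. -/
  tau : TopologicalSpace X
  complete : CompleteSpace X
  isTopologicalAddGroup : @IsTopologicalAddGroup X tau _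
  continuousSMul : @ContinuousSMul 𝕜 X _ _ tau
  t2Space : @T2Space X tau
  locallyConvexSpace : @LocallyConvexSpace ℝ X _ _ _ _ tau
  norm_le : normTopology X ≤ tau
  norming : ∀ x : X, IsLUB {r : ℝ | ∃ φ : X →ₗ[𝕜] 𝕜,
    Continuous[tau, _] φ ∧ (∀ y, ‖φ y‖ ≤ ‖y‖) ∧ r = ‖φ x‖} ‖x‖

section Saks

variable {𝕜 X : Type*} [RCLike 𝕜] [NormedAddCommGroup X] [NormedSpace 𝕜 X] [Module ℝ X]

namespace SaksSpace

/-- `γ` is a linear topology with `τ ⊆ γ ⊆ τ_{‖·‖}` that coincides with `τ` on norm-bounded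
sets. -/
structure IsMixedCandidate (sX : SaksSpace 𝕜 X) (γ : TopologicalSpace X) : Prop where
  isTopologicalAddGroup : @IsTopologicalAddGroup X γ _
  continuousSMul : @ContinuousSMul 𝕜 X _ _ γ
  le_tau : γ ≤ sX.tau
  norm_le : normTopology X ≤ γ
  eq_on_bounded : ∀ M : Set X, Bornology.IsBounded M →
    TopologicalSpace.induced ((↑) : M → X) γ = TopologicalSpace.induced ((↑) : M → X) sX.tau

/-- The mixed topology `γ = γ(‖·‖, τ)`: the finest linear topology that coincides with `τ` on
norm-bounded sets and satisfies `τ ⊆ γ ⊆ τ_{‖·‖}` (see `gamma_isLeast`). -/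
def gamma (sX : SaksSpace 𝕜 X) : TopologicalSpace X :=
  sInf {γ | sX.IsMixedCandidate γ}

/-- The mixed topology is indeed the finest of its kind. -/
theorem gamma_isLeast (sX : SaksSpace 𝕜 X) :
    IsLeast {γ | sX.IsMixedCandidate γ} sX.gamma := by
  have hτ : sX.IsMixedCandidate sX.tau :=
    ⟨sX.isTopologicalAddGroup, sX.continuousSMul, le_rfl, sX.norm_le, fun _ _ => rfl⟩
  refine ⟨⟨?_, ?_, sInf_le hτ, le_sInf fun γ hγ => hγ.norm_le, fun M hM => ?_⟩,
    fun γ hγ => sInf_le hγ⟩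
  · exact topologicalAddGroup_sInf fun γ hγ => hγ.isTopologicalAddGroup
  · exact continuousSMul_sInf fun γ hγ => hγ.continuousSMul
  · refine le_antisymm (induced_mono (sInf_le hτ)) ?_
    rw [gamma, sInf_eq_iInf, induced_iInf]
    refine le_iInf fun γ => ?_
    rw [induced_iInf]
    exact le_iInf fun hγ => (hγ.eq_on_bounded M hM).ge

/-- The Saks space is sequentially complete: every `γ`-Cauchy sequence is `γ`-convergent. -/
def IsSeqComplete (sX : SaksSpace 𝕜 X) : Prop :=
  ∀ x : ℕ → X,
    Tendsto (fun p : ℕ × ℕ => x p.1 - x p.2) atTop (@nhds X sX.gamma 0) →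
    ∃ y : X, Tendsto x atTop (@nhds X sX.gamma y)

/-- The Saks space is C-sequential: every convex, sequentially open subset of `(X, γ)` is open
in `(X, γ)`. -/
def IsCSequential (sX : SaksSpace 𝕜 X) : Prop :=
  ∀ V : Set X, Convex ℝ V →
    (∀ y ∈ V, ∀ x : ℕ → X, Tendsto x atTop (@nhds X sX.gamma y) → ∀ᶠ n in atTop, x n ∈ V) →
    IsOpen[sX.gamma] V

/-- The space `X°` of all norm-continuous linear functionals which are sequentially
`τ`-continuous on norm-bounded sets; it carries the norm of `X'`. -/
def circDual (sX : SaksSpace 𝕜 X) : Submodule 𝕜 (StrongDual 𝕜 X) where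
  carrier := {φ | ∀ (x : ℕ → X) (y : X), (∃ C : ℝ, ∀ n, ‖x n‖ ≤ C) →
    Tendsto x atTop (@nhds X sX.tau y) → Tendsto (fun n => φ (x n)) atTop (𝓝 (φ y))}
  add_mem' := fun ha hb x y hx hxy => (ha x y hx hxy).add (hb x y hx hxy)
  zero_mem' := fun _ _ _ _ => tendsto_const_nhds
  smul_mem' := fun c _ ha x y hx hxy => (ha x y hx hxy).const_smul c

end SaksSpace

/-! ### Bi-continuous semigroups and the Pettis integral -/

/-- `(S_t)_{t ≥ 0}` is a locally `τ`-bi-continuous semigroup on `X`. Only the values `S t` with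
`0 ≤ t` are relevant. -/
structure IsLocallyBiContinuous (sX : SaksSpace 𝕜 X) (S : ℝ → X →L[𝕜] X) : Prop where
  zero : S 0 = ContinuousLinearMap.id 𝕜 X
  add : ∀ s t : ℝ, 0 ≤ s → 0 ≤ t → S (s + t) = (S s).comp (S t)
  exp_bounded : ∃ M ω : ℝ, 1 ≤ M ∧ ∀ t : ℝ, 0 ≤ t → ‖S t‖ ≤ M * Real.exp (ω * t)
  continuousOn : ∀ x : X, @ContinuousOn ℝ X _ sX.tau (fun t => S t x) (Ici 0)
  locally_bi_equicontinuous : ∀ (x : ℕ → X) (y : X), (∃ C : ℝ, ∀ n, ‖x n‖ ≤ C) →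
    Tendsto x atTop (@nhds X sX.tau y) →
    ∀ t₀ : ℝ, 0 ≤ t₀ → ∀ V ∈ @nhds X sX.tau 0, ∀ᶠ n in atTop, ∀ t ∈ Icc 0 t₀, S t (x n - y) ∈ V

/-- `y` is the `τ`-Pettis integral of `f`, i.e. `⟨φ, f⟩` is integrable and
`⟨φ, y⟩ = ∫ ⟨φ, f⟩ dμ` for every `φ ∈ (X, τ)'`. -/
def IsPettisIntegral {Ω : Type*} [MeasurableSpace Ω] (sX : SaksSpace 𝕜 X) (μ : Measure Ω)
    (f : Ω → X) (y : X) : Prop :=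
  ∀ φ : X →ₗ[𝕜] 𝕜, Continuous[sX.tau, _] φ →
    Integrable (fun ω => φ (f ω)) μ ∧ φ y = ∫ ω, φ (f ω) ∂μ

open Classical in
/-- The `τ`-Pettis integral of `f` (with value `0` if `f` is not `τ`-Pettis integrable). -/
def pettisIntegral {Ω : Type*} [MeasurableSpace Ω] (sX : SaksSpace 𝕜 X) (μ : Measure Ω)
    (f : Ω → X) : X :=
  if h : ∃ y, IsPettisIntegral sX μ f y then h.choose else 0

end Saks

/-! ### The space of controls -/

section Controls

variable {𝕜 : Type*} [RCLike 𝕜] {U : Type*} [NormedAddCommGroup U] [NormedSpace 𝕜 U]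
  [Module ℝ U]

/-- The space `C_{τ,b}([0,T];U)` of `τ`-continuous, norm-bounded functions on `[0,T]`. -/
def Ctaub (sU : SaksSpace 𝕜 U) (T : ℝ) : Submodule 𝕜 (Icc (0 : ℝ) T → U) where
  carrier := {u | Continuous[_, sU.tau] u ∧ ∃ C : ℝ, ∀ t, ‖u t‖ ≤ C}
  add_mem' := by
    rintro u v ⟨hu, C, hC⟩ ⟨hv, D, hD⟩
    let _ := sU.tau
    have _ := sU.isTopologicalAddGroup
    exact ⟨hu.add hv, C + D, fun t => (norm_add_le _ _).trans (add_le_add (hC t) (hD t))⟩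
  zero_mem' := by
    let _ := sU.tau
    exact ⟨continuous_const, 0, fun t => by simp⟩
  smul_mem' := by
    rintro c u ⟨hu, C, hC⟩
    let _ := sU.tau
    have _ := sU.continuousSMul
    exact ⟨hu.const_smul c, ‖c‖ * C, fun t => by
      simpa [norm_smul] using mul_le_mul_of_nonneg_left (hC t) (norm_nonneg c)⟩

variable {sU : SaksSpace 𝕜 U} {T : ℝ}

/-- `‖u‖_∞ = sup_{t ∈ [0,T]} ‖u t‖`. -/
def supNorm (u : Ctaub sU T) : ℝ := ⨆ t, ‖u.1 t‖

/-- For a `γ_U`-continuous seminorm `p` on `U` and `u ∈ C_{τ,b}([0,T];U)`, the function `p ∘ u`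
is bounded. -/
theorem bddAbove_seminorm_comp (p : Seminorm 𝕜 U) (hp : Continuous[sU.gamma, _] p)
    (u : Ctaub sU T) : BddAbove (range fun t => p (u.1 t)) := by
  obtain ⟨-, C, hC⟩ := u.2
  have hp' : Continuous p :=
    continuous_def.2 fun V hV => sU.gamma_isLeast.1.norm_le _
      ((@continuous_def U ℝ sU.gamma _ p).1 hp V hV)
  obtain ⟨D, hD0, hD⟩ := Seminorm.bound_of_continuous_normedSpace p hp'
  refine ⟨D * C, ?_⟩
  rintro _ ⟨t, rfl⟩
  exact (hD _).trans (mul_le_mul_of_nonneg_left (hC t) hD0.le)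

/-- The seminorm `u ↦ sup_{t ∈ [0,T]} p (u t)` on `C_{τ,b}([0,T];U)`, for a `γ_U`-continuous
seminorm `p` on `U`. -/
def supSeminorm (sU : SaksSpace 𝕜 U) (T : ℝ)
    (p : {p : Seminorm 𝕜 U // Continuous[sU.gamma, _] p}) :
    Seminorm 𝕜 (Ctaub sU T) :=
  Seminorm.of (fun u => ⨆ t, p.1 (u.1 t))
    (fun u v => by
      refine Real.iSup_le (fun t => (map_add_le_add p.1 _ _).trans (add_le_add ?_ ?_))
        (add_nonneg (Real.iSup_nonneg fun t => apply_nonneg _ _)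
          (Real.iSup_nonneg fun t => apply_nonneg _ _))
      · exact le_ciSup (bddAbove_seminorm_comp p.1 p.2 u) t
      · exact le_ciSup (bddAbove_seminorm_comp p.1 p.2 v) t)
    (fun c u => by
      simp only [Submodule.coe_smul, Pi.smul_apply, map_smul_eq_mul]
      exact (Real.mul_iSup_of_nonneg (norm_nonneg c) _).symm)

/-- The topology `γ_∞` on `C_{τ,b}([0,T];U)` induced by the seminorms
`u ↦ sup_{t ∈ [0,T]} p (u t)`, `p` a `γ_U`-continuous seminorm on `U`. -/
def gammaInfty (sU : SaksSpace 𝕜 U) (T : ℝ) : TopologicalSpace (Ctaub sU T) :=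
  SeminormFamily.moduleFilterBasis (𝕜 := 𝕜) (supSeminorm sU T) |>.topology

/-- The norm on `C_{τ,b}([0,T];U)'`, and hence on its subspace `(C_{τ,b}([0,T];U), γ_∞)'`. -/
def dualNorm (φ : Ctaub sU T → 𝕜) : ℝ≥0∞ :=
  ⨆ (u : Ctaub sU T) (_ : supNorm u ≤ 1), ‖φ u‖ₑ

end Controls

/-- The semivariation (with respect to the norm of `U`) of `ν`, where `ν N` is a functional
on `U`: the supremum of `|∑ ν(N_i) u_i|` over all finite measurable partitions `(N_i)` of `Ω`
and all `u_i` in the closed unit ball of `U`. -/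
def semivariation {𝕜 : Type*} [RCLike 𝕜] {U : Type*} [NormedAddCommGroup U]
    {Ω : Type*} [MeasurableSpace Ω] (ν : Set Ω → U → 𝕜) : ℝ≥0∞ :=
  ⨆ (n : ℕ) (N : Fin n → Set Ω) (u : Fin n → U)
    (_ : (∀ i, MeasurableSet (N i)) ∧ Pairwise (fun i j => Disjoint (N i) (N j)) ∧
      ⋃ i, N i = univ)
    (_ : ∀ i, ‖u i‖ ≤ 1), ‖∑ i, ν (N i) (u i)‖ₑ

/-- Lebesgue measure on `[0,T]`. -/
def lebesgueIcc (T : ℝ) : Measure (Icc (0 : ℝ) T) := Measure.comap Subtype.val volume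

/-! ### Control system and dual observation system -/

section System

variable {𝕜 : Type*} [RCLike 𝕜]
  {X : Type*} [NormedAddCommGroup X] [NormedSpace 𝕜 X] [Module ℝ X]
  {U : Type*} [NormedAddCommGroup U] [NormedSpace 𝕜 U] [Module ℝ U]

/-- The mild solution `x(t) = S_t x₀ + ∫_0^t S_{t-r} B u(r) dr`, `t ∈ [0,T]`, of
`ẋ = -A x + B u`, `x(0) = x₀`, where `-A` is the generator of `(S_t)`; the integral is a
`τ_X`-Pettis integral. -/
def mildSolution (sX : SaksSpace 𝕜 X) {sU : SaksSpace 𝕜 U} {T : ℝ}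
    (S : ℝ → X →L[𝕜] X) (B : U →L[𝕜] X) (x₀ : X) (u : Ctaub sU T) (t : ℝ) : X :=
  S t x₀ + pettisIntegral sX ((lebesgueIcc T).restrict {r | (r : ℝ) ≤ t})
    (fun r => S (t - r) (B (u.1 r)))

/-- `𝓑^T u = ∫_0^T S_{T-t} B u(t) dt`, a `τ_X`-Pettis integral. -/
def inputMap (sX : SaksSpace 𝕜 X) {sU : SaksSpace 𝕜 U} {T : ℝ}
    (S : ℝ → X →L[𝕜] X) (B : U →L[𝕜] X) (u : Ctaub sU T) : X :=
  pettisIntegral sX (lebesgueIcc T) (fun t => S (T - t) (B (u.1 t)))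

/-- Cost-uniform approximate `τ_X`-null-controllability in time `T` via `C_{τ,b}([0,T];U)`. -/
def CostUniformApproxNullControllable (sX : SaksSpace 𝕜 X) (sU : SaksSpace 𝕜 U) (T : ℝ)
    (S : ℝ → X →L[𝕜] X) (B : U →L[𝕜] X) : Prop :=
  ∃ C : ℝ, 0 ≤ C ∧ ∀ (x₀ : X) (ε : ℝ), 0 < ε →
    ∀ p : Seminorm 𝕜 X, Continuous[sX.tau, _] p →
      ∃ u : Ctaub sU T, supNorm u ≤ C * ‖x₀‖ ∧ p (mildSolution sX S B x₀ u T) ≤ ε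

/-- The dual operator `L' φ = φ ∘ L`. The operators `S_t°` and `B°` are its restrictions
to `X°`. -/
def dualOp {V W : Type*} [NormedAddCommGroup V] [NormedSpace 𝕜 V] [NormedAddCommGroup W]
    [NormedSpace 𝕜 W] (L : V →L[𝕜] W) (φ : StrongDual 𝕜 W) : StrongDual 𝕜 V :=
  φ.comp L

/-- The final state observability estimate in `(C_{τ,b}([0,T];U), γ_∞)'` of
`ẋ = -A° x`, `y = B° x`, i.e. `‖S_T° x°‖ ≤ C_obs ‖(𝓑^T)° x°‖` for `x° ∈ X°`, where
`(𝓑^T)° x° = x° ∘ 𝓑^T`. -/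
def FinalStateObservable (sX : SaksSpace 𝕜 X) (sU : SaksSpace 𝕜 U) (T : ℝ)
    (S : ℝ → X →L[𝕜] X) (B : U →L[𝕜] X) : Prop :=
  ∃ C : ℝ≥0, ∀ φ ∈ sX.circDual,
    ‖dualOp (S T) φ‖ₑ ≤ C * dualNorm (fun u : Ctaub sU T => φ (inputMap sX S B u))

/-- The vector measure `(B° S_{(·)}° x° ⊙ λ)(N) u = ∫_N ⟨B° S_t° x°, u⟩ dt` on `[0,T]`. -/
def obsMeasure (T : ℝ) (S : ℝ → X →L[𝕜] X) (B : U →L[𝕜] X) (φ : StrongDual 𝕜 X)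
    (N : Set (Icc (0 : ℝ) T)) (u : U) : 𝕜 :=
  ∫ t in N, dualOp B (dualOp (S t) φ) u ∂(lebesgueIcc T)

/-- The final state observability estimate
`‖S_T° x°‖ ≤ C_obs ‖B° S_{(·)}° x° ⊙ λ‖_var` for `x° ∈ X°`. -/
def SemivariationObservable (sX : SaksSpace 𝕜 X) (T : ℝ)
    (S : ℝ → X →L[𝕜] X) (B : U →L[𝕜] X) : Prop :=
  ∃ C : ℝ≥0, ∀ φ ∈ sX.circDual,
    ‖dualOp (S T) φ‖ₑ ≤ C * semivariation (obsMeasure T S B φ)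

end System

end SaksControl

end

/-! The core is a Hahn–Banach duality between the reachable set `𝓑^T {‖u‖_∞ ≤ r}` and the
observation `x° ∘ 𝓑^T`.

If (a) holds and `x° ∈ X°`, then `x°(S_T x) = x°(x(T)) - x°(𝓑^T u)`. The last term is at most `‖x° ∘
𝓑^T‖ C ‖x‖`. The first is arbitrarily small: the final states of the admissible controls stay in a
fixed norm ball, where `γ` and `τ` agree, and C-sequentiality makes `x°` `γ`-continuous. If (a)
fails for a given `C`, some `τ`-neighbourhood of `-S_T x₀` misses the convex balanced set `𝓑^T
{‖u‖_∞ ≤ C ‖x₀‖}`; a separating `τ`-continuous functional lies in `X°` and violates (b).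

Existence of `𝓑^T u` rests on sequential completeness: Riemann-type sums of a bounded `τ`-continuous
integrand are norm-bounded and `τ`-Cauchy, hence `γ`-Cauchy, and elements of `X°` pass to the limit
(`IsSeqComplete.exists_integral`). For `γ_∞`-continuity of `x° ∘ 𝓑^T`, the seminorm `sup_t |x°(S_t
·)|` is shown to be sequentially continuous on bounded sets, so `γ`-continuous by
`IsCSequential.continuous_seminorm`; that lemma needs `γ`-null sequences to be norm-bounded
(`bounded_of_tendsto_gamma_zero`).

If `τ_U` is the norm topology, the norm of `x° ∘ 𝓑^T` equals the semivariation in (c), because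
continuous controls and step functions in the unit ball approximate each other under the integral.
So (b) and (c) hold with the same constants. -/

noncomputable section

namespace SaksControl

section

/-! ### Seminorms and locally convex topologies -/

section Seminorms

variable {𝕜 : Type*} [RCLike 𝕜]

/-- In a real or complex locally convex space, every neighbourhood of `0` contains the open unit
ball of a continuous seminorm. -/
theorem exists_continuous_seminorm_ball_subset {E : Type*} [AddCommGroup E] [Module 𝕜 E]
    [Module ℝ E] [IsScalarTower ℝ 𝕜 E] [TopologicalSpace E] [IsTopologicalAddGroup E]
    [ContinuousSMul 𝕜 E] [LocallyConvexSpace ℝ E] {V : Set E} (hV : V ∈ 𝓝 (0 : E)) :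
    ∃ p : Seminorm 𝕜 E, Continuous p ∧ ∀ x, p x < 1 → x ∈ V := by
  open scoped ComplexOrder in
  have := IsScalarTower.continuousSMul (M := ℝ) (α := E) 𝕜
  -- In `ComplexOrder` the nonnegative elements of `𝕜` are the nonnegative reals, so convexity over
  -- `ℝ` and over `𝕜` agree.
  have : LocallyConvexSpace 𝕜 E := by
    rw [locallyConvexSpace_iff_exists_convex_subset_zero]
    intro U hU
    obtain ⟨W, hW, hWc, hWU⟩ := (locallyConvexSpace_iff_exists_convex_subset_zero ℝ E).1 ‹_› U hU
    exact ⟨W, hW, convex_of_nonneg_surjective_algebraMap _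
        (fun _ => RCLike.nonneg_iff_exists_ofReal.mp) hWc, hWU⟩
  have hw := with_gaugeSeminormFamily (𝕜 := 𝕜) (E := E)
  obtain ⟨W, ⟨hW0, hWo, hWb, hWc⟩, hWV⟩ := (nhds_hasBasis_absConvex_open 𝕜 E).mem_iff.1 hV
  refine ⟨gaugeSeminormFamily 𝕜 E ⟨W, hW0, hWo, hWb, hWc⟩, hw.continuous_seminorm _, fun x hx => ?_⟩
  apply hWV
  have := gaugeSeminormFamily_ball (𝕜 := 𝕜) (E := E) ⟨W, hW0, hWo, hWb, hWc⟩
  have h2 : x ∈ (gaugeSeminormFamily 𝕜 E ⟨W, hW0, hWo, hWb, hWc⟩).ball 0 1 := by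
    simpa [Seminorm.mem_ball_zero] using hx
  rw [this] at h2
  exact h2

/-- The pointwise supremum of the moduli of a pointwise bounded family of functionals. -/
def supFunctional {E ι : Type*} [AddCommGroup E] [Module 𝕜 E] (ψ : ι → E →ₗ[𝕜] 𝕜)
    (h : ∀ x, BddAbove (range fun i => ‖ψ i x‖)) : Seminorm 𝕜 E :=
  Seminorm.of (fun x => ⨆ i, ‖ψ i x‖)
    (fun x y => by
      refine Real.iSup_le (fun i => ?_)
        (add_nonneg (Real.iSup_nonneg fun i => norm_nonneg _)
          (Real.iSup_nonneg fun i => norm_nonneg _))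
      rw [map_add]
      exact (norm_add_le _ _).trans (add_le_add (le_ciSup (h x) i) (le_ciSup (h y) i)))
    (fun c x => by
      simp only [map_smul, norm_smul]
      exact (Real.mul_iSup_of_nonneg (norm_nonneg c) _).symm)

theorem supFunctional_apply {E ι : Type*} [AddCommGroup E] [Module 𝕜 E] (ψ : ι → E →ₗ[𝕜] 𝕜)
    (h : ∀ x, BddAbove (range fun i => ‖ψ i x‖)) (x : E) :
    supFunctional ψ h x = ⨆ i, ‖ψ i x‖ := rfl

theorem le_supFunctional {E ι : Type*} [AddCommGroup E] [Module 𝕜 E] (ψ : ι → E →ₗ[𝕜] 𝕜)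
    (h : ∀ x, BddAbove (range fun i => ‖ψ i x‖)) (x : E) (i : ι) :
    ‖ψ i x‖ ≤ supFunctional ψ h x := le_ciSup (h x) i

/-- The linear topology defined by a single seminorm. -/
theorem exists_seminorm_topology {E : Type*} [AddCommGroup E] [Module 𝕜 E] (p : Seminorm 𝕜 E) :
    ∃ _ : TopologicalSpace E, IsTopologicalAddGroup E ∧ ContinuousSMul 𝕜 E ∧ Continuous p ∧
      ∀ (l : Filter E) (y : E), (∀ ε : ℝ, 0 < ε → ∀ᶠ x in l, p (x - y) < ε) → l ≤ 𝓝 y := by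
  let q : SeminormFamily 𝕜 E Unit := fun _ => p
  let _ : TopologicalSpace E := q.moduleFilterBasis.topology
  have hq : WithSeminorms q := ⟨rfl⟩
  exact ⟨_, hq.topologicalAddGroup, hq.continuousSMul, hq.continuous_seminorm (),
    fun l y h => (hq.tendsto_nhds id y).2 fun _ => h⟩

end Seminorms

/-! ### The mixed topology: bounded sets, null sequences, continuous seminorms -/

namespace SaksSpace

variable {𝕜 X : Type*} [RCLike 𝕜] [NormedAddCommGroup X] [NormedSpace 𝕜 X] [Module ℝ X]

/-- One closed ball contains the whole family and its limit, and `γ` and `τ` induce the same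
topology on it. -/
theorem tendsto_gamma_of_bounded (sX : SaksSpace 𝕜 X) {ι : Type*} {l : Filter ι} {x : ι → X}
    {y : X} {C : ℝ} (hC : ∀ i, ‖x i‖ ≤ C) (h : Tendsto x l (@nhds X sX.tau y)) :
    Tendsto x l (@nhds X sX.gamma y) := by
  set M : Set X := Metric.closedBall 0 (max C ‖y‖) with hM
  have hxM : ∀ i, x i ∈ M := fun i => by simp [hM, hC i]
  have hyM : y ∈ M := by simp [hM]
  have key := sX.gamma_isLeast.1.eq_on_bounded M Metric.isBounded_closedBall
  have h1 : @nhds M (.induced (↑) sX.gamma) ⟨y, hyM⟩ = @nhds M (.induced (↑) sX.tau) ⟨y, hyM⟩ := by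
    rw [key]
  rw [@nhds_induced _ _ sX.gamma, @nhds_induced _ _ sX.tau] at h1
  have h2 : Tendsto (fun i => (⟨x i, hxM i⟩ : M)) l (comap (↑) (@nhds X sX.tau y)) :=
    tendsto_comap_iff.2 h
  rw [← h1] at h2
  exact (@tendsto_comap M X (↑) (@nhds X sX.gamma y)).comp h2

theorem tendsto_tau_of_gamma (sX : SaksSpace 𝕜 X) {ι : Type*} {l : Filter ι} {x : ι → X}
    {y : X} (h : Tendsto x l (@nhds X sX.gamma y)) : Tendsto x l (@nhds X sX.tau y) :=
  h.mono_right (nhds_mono sX.gamma_isLeast.1.le_tau)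

theorem tendsto_tau_iff_sub (sX : SaksSpace 𝕜 X) {ι : Type*} {l : Filter ι} {x : ι → X} {y : X} :
    Tendsto x l (@nhds X sX.tau y) ↔ Tendsto (fun i => x i - y) l (@nhds X sX.tau 0) := by
  let _ := sX.tau
  have _ := sX.isTopologicalAddGroup
  exact tendsto_sub_nhds_zero_iff.symm

theorem continuous_of_continuous_tau (sX : SaksSpace 𝕜 X) {Y : Type*} [TopologicalSpace Y]
    {f : X → Y} (h : Continuous[sX.tau, _] f) : Continuous f :=
  continuous_le_dom sX.norm_le h

theorem continuous_of_continuous_gamma (sX : SaksSpace 𝕜 X) {Y : Type*} [TopologicalSpace Y]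
    {f : X → Y} (h : Continuous[sX.gamma, _] f) : Continuous f :=
  continuous_le_dom sX.gamma_isLeast.1.norm_le h

/-- A norm-bounded seminorm which is `τ`-continuous at `0` on norm-bounded sets is
`γ`-continuous. -/
theorem continuous_gamma_seminorm (sX : SaksSpace 𝕜 X) (p : Seminorm 𝕜 X) {C : ℝ}
    (hC : ∀ x, p x ≤ C * ‖x‖)
    (hp : ∀ R ε : ℝ, 0 < ε → ∀ᶠ x in @nhds X sX.tau 0, ‖x‖ ≤ R → p x < ε) :
    Continuous[sX.gamma, _] p := by
  have hnorm : ∀ y : X, Tendsto (fun x : X => C * ‖x - y‖) (𝓝 y) (𝓝 0) := fun y => by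
    have : Continuous fun x : X => C * ‖x - y‖ := by fun_prop
    simpa using this.tendsto y
  obtain ⟨tp, htg, hts, htc, hlim⟩ := exists_seminorm_topology p
  -- Refining `τ` by the topology of `p` changes nothing on bounded sets, so the result is a
  -- candidate; `γ`, being the finest one, makes `p` continuous.
  have hcand : sX.IsMixedCandidate (sX.tau ⊓ tp) := by
    refine ⟨?_, ?_, inf_le_left, le_inf sX.norm_le ?_, fun M hM => ?_⟩
    · exact topologicalAddGroup_inf sX.isTopologicalAddGroup htg
    · exact @continuousSMul_inf 𝕜 X _ _ sX.tau tp sX.continuousSMul hts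
    · refine (@continuous_id_iff_le X (normTopology X) tp).1
        ((@continuous_iff_continuousAt X X (normTopology X) tp id).2 fun y => ?_)
      refine hlim _ _ fun ε hε => ?_
      rw [map_id]
      filter_upwards [(hnorm y).eventually_lt_const hε] with x hx using (hC _).trans_lt hx
    · rw [induced_inf, inf_eq_left]
      refine continuous_iff_le_induced.1 ?_
      refine (@continuous_iff_continuousAt M X (.induced (↑) sX.tau) tp _).2 fun y => ?_
      refine hlim _ _ fun ε hε => ?_
      obtain ⟨D, hD⟩ := hM.exists_norm_le
      rw [eventually_map, @nhds_induced _ _ sX.tau]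
      have h1 : Tendsto (fun x : M => (x : X) - y) (comap (↑) (@nhds X sX.tau y))
          (@nhds X sX.tau 0) :=
        sX.tendsto_tau_iff_sub.1 tendsto_comap
      -- Differences of points of `M` have norm at most `2D`, so the hypothesis at `0` gives
      -- continuity at every `y ∈ M`.
      filter_upwards [h1.eventually (hp (D + D) ε hε)] with x hx
      exact hx ((norm_sub_le _ _).trans (add_le_add (hD _ x.2) (hD _ y.2)))
  exact continuous_le_dom ((sX.gamma_isLeast.2 hcand).trans inf_le_right) htc

/-- Sequences converging to `0` in the mixed topology are norm-bounded. -/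
theorem bounded_of_tendsto_gamma_zero (sX : SaksSpace 𝕜 X) {x : ℕ → X}
    (hx : Tendsto x atTop (@nhds X sX.gamma 0)) : ∃ C : ℝ, ∀ n, ‖x n‖ ≤ C := by
  by_contra! hub
  -- Every tail is unbounded; the finite sum below dominates the first `N` norms, forcing the large
  -- term into the tail.
  have hub' : ∀ C : ℝ, ∀ N : ℕ, ∃ n ≥ N, C < ‖x n‖ := by
    intro C N
    by_contra! h
    obtain ⟨n, hn⟩ := hub (max C (∑ i ∈ Finset.range N, ‖x i‖))
    rcases lt_or_ge n N with hnN | hnN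
    · have := Finset.single_le_sum (f := fun i => ‖x i‖) (fun i _ => norm_nonneg _)
        (Finset.mem_range.2 hnN)
      have := le_max_right C (∑ i ∈ Finset.range N, ‖x i‖)
      linarith
    · have := h n hnN
      have := le_max_left C (∑ i ∈ Finset.range N, ‖x i‖)
      linarith
  have hφ : ∀ k : ℕ, ∃ n ≥ k, ∃ φ : X →ₗ[𝕜] 𝕜, Continuous[sX.tau, _] φ ∧ (∀ y, ‖φ y‖ ≤ ‖y‖) ∧
      (k + 1 : ℝ) < ‖φ (x n)‖ := by
    intro k
    obtain ⟨n, hn, hnk⟩ := hub' (k + 1) k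
    obtain ⟨_, ⟨φ, h1, h2, rfl⟩, h3, -⟩ := (sX.norming (x n)).exists_between hnk
    exact ⟨n, hn, φ, h1, h2, h3⟩
  choose n hn φ hφc hφb hφx using hφ
  -- The weight `1/(k+1)` still leaves `‖ψ k (x (n k))‖ > 1`, but makes the tail of the supremum
  -- uniformly small on bounded sets. There only finitely many `τ`-continuous functionals matter, so
  -- the supremum is `γ`-continuous, contradicting `x (n k) → 0`.
  let ψ : ℕ → X →ₗ[𝕜] 𝕜 := fun k => ((k + 1 : ℝ) : 𝕜)⁻¹ • φ k
  have hψ : ∀ k y, ‖ψ k y‖ = ‖φ k y‖ / (k + 1) := by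
    intro k y
    simp only [ψ, LinearMap.smul_apply, norm_smul, norm_inv, RCLike.norm_ofReal]
    rw [abs_of_pos (by positivity), inv_mul_eq_div]
  have hψb : ∀ k y, ‖ψ k y‖ ≤ ‖y‖ / (k + 1) := fun k y => by
    rw [hψ]; exact div_le_div_of_nonneg_right (hφb k y) (by positivity)
  have hψb' : ∀ k y, ‖ψ k y‖ ≤ ‖y‖ := fun k y =>
    (hψb k y).trans (div_le_self (norm_nonneg _) (by simp))
  have hbdd : ∀ y, BddAbove (range fun k => ‖ψ k y‖) := by
    rintro y; refine ⟨‖y‖, ?_⟩; rintro _ ⟨k, rfl⟩; exact hψb' k y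
  have hp : Continuous[sX.gamma, _] (supFunctional ψ hbdd) := by
    refine sX.continuous_gamma_seminorm _ (C := 1) (fun y => ?_) fun R ε hε => ?_
    · rw [one_mul, supFunctional_apply]; exact ciSup_le fun k => hψb' k y
    · obtain ⟨N, hN⟩ := exists_nat_gt (R / (ε / 2))
      have hfin : ∀ᶠ y in @nhds X sX.tau 0, ∀ k ∈ Finset.range N, ‖ψ k y‖ < ε / 2 := by
        rw [Finset.eventually_all]
        intro k _
        let _ := sX.tau
        have h1 : Continuous fun y => ‖φ k y‖ / ((k : ℝ) + 1) := ((hφc k).norm).div_const _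
        have h2 := h1.tendsto 0
        simp only [map_zero, norm_zero, zero_div] at h2
        filter_upwards [h2.eventually_lt_const (half_pos hε)] with y hy
        rwa [hψ]
      filter_upwards [hfin] with y hy hyR
      rw [supFunctional_apply]
      refine (ciSup_le fun k => ?_).trans_lt (half_lt_self hε)
      rcases lt_or_ge k N with hk | hk
      · exact (hy k (Finset.mem_range.2 hk)).le
      · refine (hψb k y).trans ?_
        rw [div_le_iff₀ (by positivity)]
        rw [div_lt_iff₀ (half_pos hε)] at hN
        have : (N : ℝ) ≤ k := by exact_mod_cast hk
        nlinarith
  have hlim : Tendsto (fun k => supFunctional ψ hbdd (x (n k))) atTop (𝓝 0) := by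
    let _ := sX.gamma
    have h1 := (hp.tendsto 0).comp (hx.comp (tendsto_atTop_mono hn tendsto_id))
    rw [map_zero] at h1
    exact h1
  obtain ⟨k, hk⟩ := (hlim.eventually_lt_const one_pos).exists
  have h1 := le_supFunctional ψ hbdd (x (n k)) k
  have h2 : 1 < ‖ψ k (x (n k))‖ := by
    rw [hψ, lt_div_iff₀ (by positivity), one_mul]; exact hφx k
  linarith

/-- On a C-sequential Saks space, a seminorm which is sequentially `τ`-continuous at `0` along
norm-bounded sequences is `γ`-continuous. -/
theorem IsCSequential.continuous_seminorm [IsScalarTower ℝ 𝕜 X] {sX : SaksSpace 𝕜 X}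
    (hX : sX.IsCSequential) (p : Seminorm 𝕜 X)
    (hp : ∀ x : ℕ → X, (∃ C : ℝ, ∀ n, ‖x n‖ ≤ C) → Tendsto x atTop (@nhds X sX.tau 0) →
      Tendsto (fun n => p (x n)) atTop (𝓝 0)) :
    Continuous[sX.gamma, _] p := by
  let _ := sX.gamma
  have _ := sX.gamma_isLeast.1.isTopologicalAddGroup
  have _ := sX.gamma_isLeast.1.continuousSMul
  refine Seminorm.continuous (r := 1) ?_
  -- C-sequentiality applies to the unit ball of `p`. It is sequentially open because a
  -- `γ`-convergent sequence minus its limit is norm-bounded and `τ`-null.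
  refine (hX (p.ball 0 1) (p.convex_ball 0 1) fun y hy x hx => ?_).mem_nhds (by simp)
  rw [Seminorm.mem_ball_zero] at hy
  have h0 : Tendsto (fun n => x n - y) atTop (𝓝 0) := tendsto_sub_nhds_zero_iff.2 hx
  have h1 := hp _ (sX.bounded_of_tendsto_gamma_zero h0) (sX.tendsto_tau_of_gamma h0)
  filter_upwards [h1.eventually_lt_const (sub_pos.2 hy)] with n hn
  rw [Seminorm.mem_ball_zero]
  have := map_add_le_add p (x n - y) y
  rw [sub_add_cancel] at this
  linarith

end SaksSpace

end

/-! ### Pettis integration of bounded `τ`-continuous functions -/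

section

variable {𝕜 X : Type*} [RCLike 𝕜] [NormedAddCommGroup X] [NormedSpace 𝕜 X] [Module ℝ X]

/-- The real normed space structure on a normed space over `𝕜`, with the given scalar action. -/
abbrev realNormedSpace (𝕜 X : Type*) [RCLike 𝕜] [NormedAddCommGroup X] [NormedSpace 𝕜 X]
    [Module ℝ X] [IsScalarTower ℝ 𝕜 X] : NormedSpace ℝ X where
  norm_smul_le r x := by
    rw [← algebraMap_smul 𝕜 r x, norm_smul, norm_algebraMap', Real.norm_eq_abs]

/-- Jensen's inequality for a continuous seminorm. -/
theorem seminorm_integral_le {E : Type*} [NormedAddCommGroup E] [NormedSpace 𝕜 E]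
    [NormedSpace ℝ E] [IsScalarTower ℝ 𝕜 E] [CompleteSpace E] {Ω : Type*} [MeasurableSpace Ω]
    (μ : Measure Ω) [IsFiniteMeasure μ] (p : Seminorm 𝕜 E) (hp : Continuous p) {h : Ω → E}
    (hi : Integrable h μ) (hpi : Integrable (fun ω => p (h ω)) μ) :
    p (∫ ω, h ω ∂μ) ≤ ∫ ω, p (h ω) ∂μ := by
  rcases eq_or_ne μ 0 with rfl | hμ
  · simp
  have : NeZero μ := ⟨hμ⟩
  have h1 := p.convexOn.map_average_le (μ := μ) (f := h) hp.continuousOn isClosed_univ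
    (by simp) hi hpi
  rw [← measure_smul_average μ h, ← measure_smul_average μ fun ω => p (h ω),
    ← algebraMap_smul 𝕜, map_smul_eq_mul, norm_algebraMap', Real.norm_eq_abs,
    abs_of_nonneg measureReal_nonneg, smul_eq_mul]
  exact mul_le_mul_of_nonneg_left h1 measureReal_nonneg

namespace SaksSpace

theorem ofTau_mem_circDual (sX : SaksSpace 𝕜 X) {φ : X →ₗ[𝕜] 𝕜} (hφ : Continuous[sX.tau, _] φ) :
    (⟨φ, sX.continuous_of_continuous_tau hφ⟩ : StrongDual 𝕜 X) ∈ sX.circDual := by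
  intro x y _ hx
  let _ := sX.tau
  exact (hφ.tendsto y).comp hx

theorem exists_seminorm_ball_subset [IsScalarTower ℝ 𝕜 X] (sX : SaksSpace 𝕜 X) {V : Set X}
    (hV : V ∈ @nhds X sX.tau 0) :
    ∃ p : Seminorm 𝕜 X, Continuous[sX.tau, _] p ∧ ∀ x, p x < 1 → x ∈ V := by
  let _ := sX.tau
  have _ := sX.isTopologicalAddGroup
  have _ := sX.continuousSMul
  have _ := sX.locallyConvexSpace
  exact exists_continuous_seminorm_ball_subset hV

/-- The norming property makes `(X, τ)'` separate points; this gives uniqueness of Pettis integrals.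
-/
theorem eq_zero_of_forall_tau (sX : SaksSpace 𝕜 X) {x : X}
    (h : ∀ φ : X →ₗ[𝕜] 𝕜, Continuous[sX.tau, _] φ → φ x = 0) : x = 0 := by
  rw [← norm_le_zero_iff]
  refine (sX.norming x).2 ?_
  rintro _ ⟨φ, h1, -, rfl⟩
  simp [h φ h1]

/-- Elements of `X°` are continuous along `τ`-continuous bounded functions on a sequential
space. -/
theorem continuous_circDual_comp (sX : SaksSpace 𝕜 X) {Ω : Type*} [TopologicalSpace Ω]
    [SequentialSpace Ω] {f : Ω → X} (hf : Continuous[_, sX.tau] f) {C : ℝ} (hC : ∀ ω, ‖f ω‖ ≤ C)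
    {φ : StrongDual 𝕜 X} (hφ : φ ∈ sX.circDual) : Continuous fun ω => φ (f ω) := by
  refine continuous_iff_seqContinuous.2 fun x a hx => ?_
  refine hφ (fun n => f (x n)) (f a) ⟨C, fun n => hC _⟩ ?_
  let _ := sX.tau
  exact (hf.tendsto a).comp hx

/-- A bounded `τ`-continuous function is `τ`-Pettis integrable, and its integral commutes with
all functionals in `X°`. -/
theorem IsSeqComplete.exists_integral [IsScalarTower ℝ 𝕜 X] {sX : SaksSpace 𝕜 X}
    (hX : sX.IsSeqComplete) {Ω : Type*} [PseudoMetricSpace Ω] [SecondCountableTopology Ω]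
    [Nonempty Ω] [MeasurableSpace Ω] [BorelSpace Ω] (μ : Measure Ω) [IsFiniteMeasure μ] {f : Ω → X}
    (hf : Continuous[_, sX.tau] f) {C : ℝ} (hC : ∀ ω, ‖f ω‖ ≤ C) :
    ∃ y, ∀ φ ∈ sX.circDual,
      Integrable (fun ω => φ (f ω)) μ ∧ φ y = ∫ ω, φ (f ω) ∂μ := by
  let _ : NormedSpace ℝ X := realNormedSpace 𝕜 X
  have _ := sX.complete
  obtain ⟨ω₀⟩ := ‹Nonempty Ω›
  -- The variable is discretised rather than the values: `f ∘ π n` is simple, hence Bochner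
  -- integrable, although `f` need not be norm-measurable.
  let π : ℕ → SimpleFunc Ω Ω := SimpleFunc.approxOn id measurable_id univ ω₀ (mem_univ _)
  have hπ : ∀ ω, Tendsto (fun n => π n ω) atTop (𝓝 ω) := fun ω =>
    SimpleFunc.tendsto_approxOn measurable_id (mem_univ _) (by simp)
  have hfπ : ∀ ω, Tendsto (fun n => f (π n ω)) atTop (@nhds X sX.tau (f ω)) := fun ω => by
    let _ := sX.tau
    exact (hf.tendsto ω).comp (hπ ω)
  have hfi : ∀ n, Integrable (fun ω => f (π n ω)) μ := fun n =>
    Integrable.of_bound ((π n).map f).aestronglyMeasurable C (ae_of_all _ fun ω => hC _)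
  let R : ℕ → X := fun n => ∫ ω, f (π n ω) ∂μ
  have hRC : ∀ n, ‖R n‖ ≤ C * μ.real univ := fun n =>
    norm_integral_le_of_norm_le_const (ae_of_all _ fun ω => hC _)
  -- The differences are bounded, so `τ`-convergence suffices. It follows for each `τ`-continuous
  -- seminorm from Jensen's inequality and dominated convergence along pairs of indices.
  have hcauchy : Tendsto (fun q : ℕ × ℕ => R q.1 - R q.2) atTop (@nhds X sX.gamma 0) := by
    refine sX.tendsto_gamma_of_bounded (C := C * μ.real univ + C * μ.real univ)
      (fun q => (norm_sub_le _ _).trans (add_le_add (hRC _) (hRC _))) fun V hV => ?_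
    obtain ⟨p, hpc, hpV⟩ := sX.exists_seminorm_ball_subset hV
    have hpn := sX.continuous_of_continuous_tau hpc
    obtain ⟨D, hD0, hD⟩ := Seminorm.bound_of_continuous_normedSpace p hpn
    have hmeas : ∀ q : ℕ × ℕ,
        AEStronglyMeasurable (fun ω => p (f (π q.1 ω) - f (π q.2 ω))) μ := fun q =>
      (((π q.1).pair (π q.2)).map fun z : Ω × Ω => p (f z.1 - f z.2)).aestronglyMeasurable
    have hbd : ∀ (q : ℕ × ℕ) ω, ‖p (f (π q.1 ω) - f (π q.2 ω))‖ ≤ D * (C + C) := fun q ω => by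
      rw [Real.norm_of_nonneg (apply_nonneg _ _)]
      exact (hD _).trans (mul_le_mul_of_nonneg_left
        ((norm_sub_le _ _).trans (add_le_add (hC _) (hC _))) hD0.le)
    have hlim : Tendsto (fun q : ℕ × ℕ => ∫ ω, p (f (π q.1 ω) - f (π q.2 ω)) ∂μ) atTop
        (𝓝 (∫ _, (0 : ℝ) ∂μ)) := by
      refine tendsto_integral_filter_of_dominated_convergence (fun _ => D * (C + C))
        (Eventually.of_forall hmeas) (Eventually.of_forall fun q => ae_of_all _ (hbd q))
        (integrable_const _) (ae_of_all _ fun ω => ?_)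
      have h1 : Tendsto (fun q : ℕ × ℕ => f (π q.1 ω) - f (π q.2 ω)) atTop
          (@nhds X sX.tau 0) := by
        let _ := sX.tau
        have _ := sX.isTopologicalAddGroup
        rw [← prod_atTop_atTop_eq]
        have h2 := ((hfπ ω).comp tendsto_fst).sub ((hfπ ω).comp (tendsto_snd (f := (atTop : Filter ℕ))))
        rw [sub_self] at h2
        exact h2
      let _ := sX.tau
      have h2 := (hpc.tendsto 0).comp h1
      rw [map_zero] at h2
      exact h2
    rw [integral_zero] at hlim
    rw [mem_map]
    filter_upwards [hlim.eventually_lt_const one_pos] with q hq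
    refine hpV _ (lt_of_le_of_lt ?_ hq)
    change p (∫ ω, f (π q.1 ω) ∂μ - ∫ ω, f (π q.2 ω) ∂μ) ≤ _
    rw [← integral_sub (hfi _) (hfi _)]
    exact seminorm_integral_le μ p hpn ((hfi _).sub (hfi _))
      (Integrable.of_bound (hmeas q) _ (ae_of_all _ (hbd q)))
  obtain ⟨y, hy⟩ := hX R hcauchy
  refine ⟨y, fun φ hφ => ?_⟩
  have hφf := sX.continuous_circDual_comp hf hC hφ
  have hφC : ∀ ω, ‖φ (f ω)‖ ≤ ‖φ‖ * C := fun ω =>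
    (φ.le_opNorm _).trans (mul_le_mul_of_nonneg_left (hC ω) (norm_nonneg _))
  refine ⟨Integrable.of_bound hφf.aestronglyMeasurable _ (ae_of_all _ hφC), ?_⟩
  -- The sums `R n` are bounded and `τ`-convergent to `y`, which is what a functional in `X°` needs
  -- to pass to the limit.
  refine tendsto_nhds_unique (hφ R y ⟨_, hRC⟩ (sX.tendsto_tau_of_gamma hy)) ?_
  have h1 : ∀ n, φ (R n) = ∫ ω, φ (f (π n ω)) ∂μ := fun n =>
    (φ.integral_comp_comm (hfi n)).symm
  simp_rw [h1]
  refine tendsto_integral_of_dominated_convergence (fun _ => ‖φ‖ * C)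
    (fun n => ((π n).map fun ω => φ (f ω)).aestronglyMeasurable) (integrable_const _)
    (fun n => ae_of_all _ fun ω => hφC _)
    (ae_of_all _ fun ω => (hφf.tendsto ω).comp (hπ ω))

/-- A `γ`-continuous seminorm is small on bounded `τ`-small vectors. -/
theorem eventually_tau_lt (sX : SaksSpace 𝕜 X) {p : Seminorm 𝕜 X} (hp : Continuous[sX.gamma, _] p)
    (R ε : ℝ) (hε : 0 < ε) : ∀ᶠ x in @nhds X sX.tau 0, ‖x‖ ≤ R → p x < ε := by
  have h1 : Tendsto (fun x : Metric.closedBall (0 : X) R => (x : X))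
      (comap (↑) (@nhds X sX.tau 0)) (@nhds X sX.gamma 0) :=
    sX.tendsto_gamma_of_bounded (C := R) (fun x => mem_closedBall_zero_iff.1 x.2) tendsto_comap
  have h2 : ∀ᶠ x in @nhds X sX.gamma 0, p x < ε := by
    let _ := sX.gamma
    have := hp.tendsto 0
    rw [map_zero] at this
    exact this.eventually_lt_const hε
  have h3 := h1.eventually h2
  rw [eventually_comap] at h3
  filter_upwards [h3] with x hx hxR
  exact hx ⟨x, by simpa using hxR⟩ rfl

end SaksSpace

end

/-! ### Lebesgue measure on `[0,T]`, orbits of the semigroup and the input map -/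

section

variable {𝕜 : Type*} [RCLike 𝕜]
  {X : Type*} [NormedAddCommGroup X] [NormedSpace 𝕜 X] [Module ℝ X]
  {U : Type*} [NormedAddCommGroup U] [NormedSpace 𝕜 U] [Module ℝ U]

theorem lebesgueIcc_univ (T : ℝ) : lebesgueIcc T univ = ENNReal.ofReal T := by
  have : lebesgueIcc T univ = volume (Icc 0 T) := Measure.Subtype.volume_univ
    measurableSet_Icc.nullMeasurableSet
  rw [this, Real.volume_Icc, sub_zero]

instance isFiniteMeasure_lebesgueIcc (T : ℝ) : IsFiniteMeasure (lebesgueIcc T) :=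
  ⟨by rw [lebesgueIcc_univ]; exact ENNReal.ofReal_lt_top⟩

theorem lebesgueIcc_real_univ {T : ℝ} (hT : 0 ≤ T) : (lebesgueIcc T).real univ = T := by
  rw [measureReal_def, lebesgueIcc_univ, ENNReal.toReal_ofReal hT]

/-- Time reversal on `[0,T]`. -/
def reflect (T : ℝ) (t : Icc (0 : ℝ) T) : Icc (0 : ℝ) T :=
  ⟨T - t, sub_nonneg.2 t.2.2, sub_le_self _ t.2.1⟩

@[simp] theorem coe_reflect (T : ℝ) (t : Icc (0 : ℝ) T) : (reflect T t : ℝ) = T - t := rfl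

@[simp] theorem reflect_reflect (T : ℝ) (t : Icc (0 : ℝ) T) : reflect T (reflect T t) = t :=
  Subtype.ext (by simp)

theorem continuous_reflect (T : ℝ) : Continuous (reflect T) :=
  (continuous_const.sub continuous_subtype_val).subtype_mk _

theorem measurePreserving_reflect (T : ℝ) :
    MeasurePreserving (reflect T) (lebesgueIcc T) (lebesgueIcc T) := by
  refine ⟨(continuous_reflect T).measurable, Measure.ext fun s hs => ?_⟩
  have hc : ∀ A : Set (Icc (0 : ℝ) T), MeasurableSet A →
      lebesgueIcc T A = volume ((↑) '' A : Set ℝ) := fun A hA =>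
    comap_subtype_coe_apply measurableSet_Icc volume A
  rw [Measure.map_apply (continuous_reflect T).measurable hs, hc _ hs,
    hc _ ((continuous_reflect T).measurable hs)]
  have h1 : ((↑) '' (reflect T ⁻¹' s) : Set ℝ) = (fun x => T - x) ⁻¹' ((↑) '' s : Set ℝ) := by
    ext x
    constructor
    · rintro ⟨t, ht, rfl⟩
      exact ⟨reflect T t, ht, rfl⟩
    · rintro ⟨t, ht, htx⟩
      refine ⟨reflect T t, by simpa using ht, ?_⟩
      rw [coe_reflect, htx]; ring
  rw [h1]
  exact ((volume : Measure ℝ).measurePreserving_sub_left T).measure_preimage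
    (MeasurableEmbedding.subtype_coe measurableSet_Icc |>.measurableSet_image.2 hs).nullMeasurableSet

theorem integral_reflect {E : Type*} [NormedAddCommGroup E] [NormedSpace ℝ E] (T : ℝ)
    (f : Icc (0 : ℝ) T → E) :
    ∫ t, f (reflect T t) ∂lebesgueIcc T = ∫ t, f t ∂lebesgueIcc T := by
  let e : Icc (0 : ℝ) T ≃ᵐ Icc (0 : ℝ) T :=
    { toFun := reflect T
      invFun := reflect T
      left_inv := reflect_reflect T
      right_inv := reflect_reflect T
      measurable_toFun := (continuous_reflect T).measurable
      measurable_invFun := (continuous_reflect T).measurable }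
  exact (measurePreserving_reflect T).integral_comp e.measurableEmbedding f

namespace IsLocallyBiContinuous

variable {sX : SaksSpace 𝕜 X} {S : ℝ → X →L[𝕜] X}

theorem exists_norm_le (hS : IsLocallyBiContinuous sX S) (T : ℝ) :
    ∃ K : ℝ, 0 ≤ K ∧ ∀ t ∈ Icc 0 T, ‖S t‖ ≤ K := by
  obtain ⟨M, ω, hM, h⟩ := hS.exp_bounded
  refine ⟨M * Real.exp (|ω| * T), by positivity, fun t ht => (h t ht.1).trans ?_⟩
  gcongr
  · exact ht.1
  · exact le_abs_self ω
  · exact ht.2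

/-- For a bounded `τ`-continuous `v`, the function `t ↦ S (σ t) (v t)` is `τ`-continuous. -/
theorem continuous_orbit (hS : IsLocallyBiContinuous sX S) {T : ℝ} {v : Icc (0 : ℝ) T → X}
    (hv : Continuous[_, sX.tau] v) {C : ℝ} (hC : ∀ t, ‖v t‖ ≤ C)
    {σ : Icc (0 : ℝ) T → Icc (0 : ℝ) T} (hσ : Continuous σ) :
    Continuous[_, sX.tau] fun t => S (σ t) (v t) := by
  let _ := sX.tau
  have _ := sX.isTopologicalAddGroup
  refine continuous_iff_seqContinuous.2 fun x a hx => ?_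
  -- Split off the change of the vector, handled by local bi-equicontinuity uniformly in time; the
  -- change of time at the fixed vector `v a` is strong `τ`-continuity.
  have h1 : Tendsto (fun n => S (σ (x n)) (v (x n) - v a)) atTop (𝓝 0) := by
    intro V hV
    rw [mem_map]
    filter_upwards [hS.locally_bi_equicontinuous (fun n => v (x n)) (v a) ⟨C, fun n => hC _⟩
      ((hv.tendsto a).comp hx) T (a.2.1.trans a.2.2) V hV] with n hn
    exact hn _ (σ (x n)).2
  have h2 : Tendsto (fun n => S (σ (x n)) (v a)) atTop (𝓝 (S (σ a) (v a))) := by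
    have hc : ContinuousOn (fun t => S t (v a)) (Ici 0) := hS.continuousOn (v a)
    have hc' : Continuous fun t : Icc (0 : ℝ) T => S t (v a) :=
      hc.comp_continuous continuous_subtype_val fun t => t.2.1
    exact (hc'.tendsto _).comp ((hσ.tendsto a).comp hx)
  have h3 := h1.add h2
  simp only [map_sub, sub_add_cancel, zero_add] at h3
  exact h3

end IsLocallyBiContinuous

variable {sX : SaksSpace 𝕜 X} {sU : SaksSpace 𝕜 U}
  {S : ℝ → X →L[𝕜] X} {B : U →L[𝕜] X} {T : ℝ}

theorem norm_le_supNorm (u : Ctaub sU T) (t : Icc (0 : ℝ) T) : ‖u.1 t‖ ≤ supNorm u := by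
  obtain ⟨-, C, hC⟩ := u.2
  exact le_ciSup (f := fun t => ‖u.1 t‖) ⟨C, by rintro _ ⟨s, rfl⟩; exact hC s⟩ t

theorem supNorm_nonneg (u : Ctaub sU T) : 0 ≤ supNorm u :=
  Real.iSup_nonneg fun _ => norm_nonneg _

theorem supNorm_le {u : Ctaub sU T} {C : ℝ} (hC0 : 0 ≤ C) (hC : ∀ t, ‖u.1 t‖ ≤ C) :
    supNorm u ≤ C := Real.iSup_le hC hC0

theorem supNorm_smul (c : 𝕜) (u : Ctaub sU T) : supNorm (c • u) = ‖c‖ * supNorm u := by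
  simp only [supNorm, Submodule.coe_smul, Pi.smul_apply, norm_smul]
  exact (Real.mul_iSup_of_nonneg (norm_nonneg c) _).symm

theorem mildSolution_final (x₀ : X) (u : Ctaub sU T) :
    mildSolution sX S B x₀ u T = S T x₀ + inputMap sX S B u := by
  have : {r : Icc (0 : ℝ) T | (r : ℝ) ≤ T} = univ := eq_univ_of_forall fun r => r.2.2
  rw [mildSolution, this, Measure.restrict_univ, inputMap]

theorem continuous_comp_of_continuousOn_bounded
    (hB : ∀ M : Set U, Bornology.IsBounded M → @ContinuousOn U X sU.tau sX.tau B M)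
    (u : Ctaub sU T) : Continuous[_, sX.tau] fun t => B (u.1 t) := by
  obtain ⟨hu, C, hC⟩ := u.2
  let _ := sU.tau
  let _ := sX.tau
  have h : ContinuousOn B (Metric.closedBall (0 : U) C) := hB _ Metric.isBounded_closedBall
  exact h.comp_continuous hu fun t => mem_closedBall_zero_iff.2 (hC t)

theorem continuous_input_integrand (hS : IsLocallyBiContinuous sX S)
    (hB : ∀ M : Set U, Bornology.IsBounded M → @ContinuousOn U X sU.tau sX.tau B M)
    (u : Ctaub sU T) : Continuous[_, sX.tau] fun t : Icc (0 : ℝ) T => S (T - t) (B (u.1 t)) :=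
  hS.continuous_orbit (continuous_comp_of_continuousOn_bounded hB u)
    (fun t => (B.le_opNorm _).trans
      (mul_le_mul_of_nonneg_left (norm_le_supNorm u t) (norm_nonneg B))) (continuous_reflect T)

theorem exists_norm_input_integrand_le {V : Type*} [NormedAddCommGroup V] [NormedSpace 𝕜 V]
    (hS : IsLocallyBiContinuous sX S) (B : V →L[𝕜] X) (T : ℝ) :
    ∃ K : ℝ, 0 ≤ K ∧ ∀ (t : Icc (0 : ℝ) T) (v : V), ‖S t (B v)‖ ≤ K * ‖v‖ := by
  obtain ⟨K, hK0, hK⟩ := hS.exists_norm_le T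
  refine ⟨K * ‖B‖, by positivity, fun t v => ?_⟩
  rw [mul_assoc]
  exact ((S t).le_opNorm _).trans (mul_le_mul (hK t t.2) (B.le_opNorm v) (norm_nonneg _) hK0)

variable [IsScalarTower ℝ 𝕜 X]

/-- The integral defining `𝓑^T u` commutes with all functionals in `X°`. -/
theorem inputMap_spec (hX : sX.IsSeqComplete) (hS : IsLocallyBiContinuous sX S)
    (hB : ∀ M : Set U, Bornology.IsBounded M → @ContinuousOn U X sU.tau sX.tau B M)
    (hT : 0 < T) (u : Ctaub sU T) {φ : StrongDual 𝕜 X} (hφ : φ ∈ sX.circDual) :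
    Integrable (fun t : Icc (0 : ℝ) T => φ (S (T - t) (B (u.1 t)))) (lebesgueIcc T) ∧
      φ (inputMap sX S B u) = ∫ t, φ (S (T - t) (B (u.1 t))) ∂lebesgueIcc T := by
  obtain ⟨K, hK0, hK⟩ := exists_norm_input_integrand_le hS B T
  have : Nonempty (Icc (0 : ℝ) T) := ⟨⟨0, le_rfl, hT.le⟩⟩
  obtain ⟨y, hy⟩ := hX.exists_integral (lebesgueIcc T) (continuous_input_integrand hS hB u)
    (C := K * supNorm u) fun t => (hK (reflect T t) _).trans
      (mul_le_mul_of_nonneg_left (norm_le_supNorm u t) hK0)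
  have hP : IsPettisIntegral sX (lebesgueIcc T)
      (fun t : Icc (0 : ℝ) T => S (T - t) (B (u.1 t))) y :=
    fun ψ hψ => hy _ (sX.ofTau_mem_circDual hψ)
  have hex : ∃ z, IsPettisIntegral sX (lebesgueIcc T)
      (fun t : Icc (0 : ℝ) T => S (T - t) (B (u.1 t))) z := ⟨y, hP⟩
  -- The chosen Pettis integral is tested only against `(X, τ)'`. Since that space separates points,
  -- it is the constructed `y`, and so satisfies the identity on all of `X°`.
  have hyu : inputMap sX S B u = y := by
    rw [inputMap, pettisIntegral, dif_pos hex]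
    rw [← sub_eq_zero]
    refine sX.eq_zero_of_forall_tau fun ψ hψ => ?_
    rw [map_sub, (hex.choose_spec ψ hψ).2, (hP ψ hψ).2, sub_self]
  rw [hyu]
  exact hy φ hφ

theorem isPettisIntegral_inputMap (hX : sX.IsSeqComplete) (hS : IsLocallyBiContinuous sX S)
    (hB : ∀ M : Set U, Bornology.IsBounded M → @ContinuousOn U X sU.tau sX.tau B M)
    (hT : 0 < T) (u : Ctaub sU T) : IsPettisIntegral sX (lebesgueIcc T)
      (fun t : Icc (0 : ℝ) T => S (T - t) (B (u.1 t))) (inputMap sX S B u) :=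
  fun _ hψ => inputMap_spec hX hS hB hT u (sX.ofTau_mem_circDual hψ)

/-- The input map as a linear map. -/
def inputMapₗ (hX : sX.IsSeqComplete) (hS : IsLocallyBiContinuous sX S)
    (hB : ∀ M : Set U, Bornology.IsBounded M → @ContinuousOn U X sU.tau sX.tau B M)
    (hT : 0 < T) : Ctaub sU T →ₗ[𝕜] X where
  toFun := inputMap sX S B
  map_add' u v := by
    rw [← sub_eq_zero]
    refine sX.eq_zero_of_forall_tau fun ψ hψ => ?_
    have h := fun u => isPettisIntegral_inputMap hX hS hB hT u ψ hψ
    rw [map_sub, map_add, (h _).2, (h _).2, (h _).2, ← integral_add (h _).1 (h _).1, sub_eq_zero]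
    simp
  map_smul' c u := by
    rw [← sub_eq_zero]
    refine sX.eq_zero_of_forall_tau fun ψ hψ => ?_
    have h := fun u => isPettisIntegral_inputMap hX hS hB hT u ψ hψ
    rw [map_sub, RingHom.id_apply, map_smul, (h _).2, (h _).2, smul_eq_mul,
      ← integral_const_mul, sub_eq_zero]
    simp

end

/-! ### `γ_∞`-continuity of `x° ∘ 𝓑^T` -/

section

variable {𝕜 : Type*} [RCLike 𝕜]
  {X : Type*} [NormedAddCommGroup X] [NormedSpace 𝕜 X] [Module ℝ X]
  {U : Type*} [NormedAddCommGroup U] [NormedSpace 𝕜 U] [Module ℝ U]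
  {sX : SaksSpace 𝕜 X} {sU : SaksSpace 𝕜 U}
  {S : ℝ → X →L[𝕜] X} {B : U →L[𝕜] X} {T : ℝ}

/-- Pulling back a `γ`-continuous seminorm along an operator which is `τ`-`τ`-continuous on
norm-bounded sets gives a `γ`-continuous seminorm. -/
theorem continuous_gamma_seminorm_comp
    (hB : ∀ M : Set U, Bornology.IsBounded M → @ContinuousOn U X sU.tau sX.tau B M)
    {p : Seminorm 𝕜 X} (hp : Continuous[sX.gamma, _] p) :
    Continuous[sU.gamma, _] (p.comp (B : U →ₗ[𝕜] X)) := by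
  obtain ⟨D, hD0, hD⟩ := Seminorm.bound_of_continuous_normedSpace p
    (sX.continuous_of_continuous_gamma hp)
  refine sU.continuous_gamma_seminorm _ (C := D * ‖B‖) (fun v => ?_) fun R ε hε => ?_
  · rw [mul_assoc]
    exact (hD _).trans (mul_le_mul_of_nonneg_left (B.le_opNorm v) hD0.le)
  · rcases lt_or_ge R 0 with hR | hR
    · exact Eventually.of_forall fun v hv => absurd (norm_nonneg v) (by linarith)
    have h1 := sX.eventually_tau_lt hp (‖B‖ * R) ε hε
    let _ := sU.tau
    let _ := sX.tau
    have h2 : ContinuousWithinAt B (Metric.closedBall (0 : U) R) 0 :=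
      hB _ Metric.isBounded_closedBall _ (mem_closedBall_zero_iff.2 (by simpa using hR))
    have h3 := h2.tendsto
    rw [map_zero] at h3
    have h4 := eventually_nhdsWithin_iff.1 (h3.eventually h1)
    filter_upwards [h4] with v hv hvR
    exact hv (mem_closedBall_zero_iff.2 hvR)
      ((B.le_opNorm v).trans (mul_le_mul_of_nonneg_left hvR (norm_nonneg B)))

variable [IsScalarTower ℝ 𝕜 X]

/-- C-sequentiality upgrades sequential continuity on bounded sets to `γ`-continuity. -/
theorem continuous_gamma_norm_circDual (hXs : sX.IsCSequential) {φ : StrongDual 𝕜 X}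
    (hφ : φ ∈ sX.circDual) :
    Continuous[sX.gamma, _] ((normSeminorm 𝕜 𝕜).comp (φ : X →ₗ[𝕜] 𝕜)) := by
  refine hXs.continuous_seminorm _ fun x hx hx0 => ?_
  have := (hφ x 0 hx hx0).norm
  simpa using this

/-- The seminorm `x ↦ sup_{t ∈ [0,T]} |⟨φ, S_t x⟩|` is dominated by a `γ`-continuous one. -/
theorem exists_seminorm_orbit (hXs : sX.IsCSequential) (hS : IsLocallyBiContinuous sX S)
    (hT : 0 < T) {φ : StrongDual 𝕜 X} (hφ : φ ∈ sX.circDual) :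
    ∃ p : Seminorm 𝕜 X, Continuous[sX.gamma, _] p ∧
      ∀ (t : Icc (0 : ℝ) T) (x : X), ‖φ (S t x)‖ ≤ p x := by
  obtain ⟨K, hK0, hK⟩ := hS.exists_norm_le T
  have : Nonempty (Icc (0 : ℝ) T) := ⟨⟨0, le_rfl, hT.le⟩⟩
  let ψ : Icc (0 : ℝ) T → X →ₗ[𝕜] 𝕜 := fun t => (φ.comp (S t) : X →ₗ[𝕜] 𝕜)
  have hψ : ∀ (t : Icc (0 : ℝ) T) x, ‖ψ t x‖ ≤ ‖φ‖ * (K * ‖x‖) := fun t x =>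
    (φ.le_opNorm _).trans (mul_le_mul_of_nonneg_left
      (((S t).le_opNorm x).trans (mul_le_mul_of_nonneg_right (hK t t.2) (norm_nonneg x)))
      (norm_nonneg φ))
  have hb : ∀ x, BddAbove (range fun t => ‖ψ t x‖) := by
    rintro x; refine ⟨‖φ‖ * (K * ‖x‖), ?_⟩; rintro _ ⟨t, rfl⟩; exact hψ t x
  refine ⟨supFunctional ψ hb, hXs.continuous_seminorm _ fun x hx hx0 => ?_,
    fun t x => le_supFunctional ψ hb x t⟩
  -- Choose times attaining the supremum up to `1/(n+1)`. Bi-equicontinuity is uniform in `t`, so `S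
  -- (t n) (x n)` is bounded and `τ`-null, and `φ` sends it to `0`.
  have hex : ∀ n : ℕ, ∃ t, supFunctional ψ hb (x n) - 1 / ((n : ℝ) + 1) < ‖ψ t (x n)‖ := fun n =>
    exists_lt_of_lt_ciSup (sub_lt_self _ (by positivity))
  choose t ht using hex
  obtain ⟨C, hC⟩ := hx
  have h1 : Tendsto (fun n => S (t n) (x n)) atTop (@nhds X sX.tau 0) := by
    intro V hV
    rw [mem_map]
    filter_upwards [hS.locally_bi_equicontinuous x 0 ⟨C, hC⟩ hx0 T hT.le V hV] with n hn
    simpa using hn (t n) (t n).2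
  have h2 : Tendsto (fun n => ‖ψ (t n) (x n)‖) atTop (𝓝 0) := by
    have := (hφ (fun n => S (t n) (x n)) 0 ⟨K * C, fun n => ((S (t n)).le_opNorm _).trans
      (mul_le_mul (hK _ (t n).2) (hC n) (norm_nonneg _) hK0)⟩ h1).norm
    rw [map_zero, norm_zero] at this
    exact this
  have h3 := h2.add tendsto_one_div_add_atTop_nhds_zero_nat
  rw [add_zero] at h3
  exact squeeze_zero (fun n => apply_nonneg _ _) (fun n => by linarith [ht n]) h3

/-- `x° ∘ 𝓑^T` is `γ_∞`-continuous for `x° ∈ X°`. -/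
theorem exists_continuous_comp_inputMap (hX : sX.IsSeqComplete) (hXs : sX.IsCSequential)
    (hS : IsLocallyBiContinuous sX S)
    (hB : ∀ M : Set U, Bornology.IsBounded M → @ContinuousOn U X sU.tau sX.tau B M)
    (hT : 0 < T) {φ : StrongDual 𝕜 X} (hφ : φ ∈ sX.circDual) :
    ∃ ψ : Ctaub sU T →ₗ[𝕜] 𝕜, Continuous[gammaInfty sU T, _] ψ ∧
      ∀ u, ψ u = φ (inputMap sX S B u) := by
  refine ⟨(φ : X →ₗ[𝕜] 𝕜) ∘ₗ inputMapₗ hX hS hB hT, ?_, fun u => rfl⟩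
  obtain ⟨p, hp, hpφ⟩ := exists_seminorm_orbit hXs hS hT hφ
  let q : {p : Seminorm 𝕜 U // Continuous[sU.gamma, _] p} :=
    ⟨p.comp (B : U →ₗ[𝕜] X), continuous_gamma_seminorm_comp hB hp⟩
  have hle : ∀ u : Ctaub sU T, ‖φ (inputMap sX S B u)‖ ≤ T * supSeminorm sU T q u := fun u => by
    rw [(inputMap_spec hX hS hB hT u hφ).2, mul_comm]
    refine (norm_integral_le_of_norm_le_const (C := supSeminorm sU T q u)
      (ae_of_all _ fun t => ?_)).trans_eq (by rw [lebesgueIcc_real_univ hT.le])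
    exact (hpφ (reflect T t) _).trans (le_ciSup (bddAbove_seminorm_comp q.1 q.2 u) t)
  let _ := gammaInfty sU T
  have hw : WithSeminorms (supSeminorm (𝕜 := 𝕜) sU T) := ⟨rfl⟩
  have _ := hw.topologicalAddGroup
  refine continuous_of_continuousAt_zero
    ((φ : X →ₗ[𝕜] 𝕜) ∘ₗ inputMapₗ hX hS hB hT) ?_
  have h1 := (hw.continuous_seminorm q).tendsto 0
  rw [map_zero] at h1
  have h2 := h1.const_mul T
  rw [mul_zero] at h2
  rw [ContinuousAt, map_zero]
  exact squeeze_zero_norm hle h2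

end

/-! ### Equivalence of (a) and (b) -/

section

variable {𝕜 : Type*} [RCLike 𝕜]
  {X : Type*} [NormedAddCommGroup X] [NormedSpace 𝕜 X] [Module ℝ X]
  {U : Type*} [NormedAddCommGroup U] [NormedSpace 𝕜 U] [Module ℝ U]
  {sX : SaksSpace 𝕜 X} {sU : SaksSpace 𝕜 U}
  {S : ℝ → X →L[𝕜] X} {B : U →L[𝕜] X} {T : ℝ}

theorem norm_le_dualNorm_mul_supNorm (ψ : Ctaub sU T →ₗ[𝕜] 𝕜) (hψ : dualNorm ψ ≠ ⊤)
    (u : Ctaub sU T) : ‖ψ u‖ ≤ (dualNorm ψ).toReal * supNorm u := by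
  rcases (supNorm_nonneg u).eq_or_lt with h0 | h0
  · have : u = 0 := by
      ext t
      have := norm_le_supNorm u t
      rw [← h0] at this
      simpa using this
    simp [this, supNorm]
  · set v : Ctaub sU T := ((supNorm u)⁻¹ : 𝕜) • u with hv
    have h1 : supNorm v ≤ 1 := by
      rw [hv, supNorm_smul, norm_inv, RCLike.norm_ofReal, abs_of_pos h0, inv_mul_cancel₀ h0.ne']
    have h2 : ‖ψ v‖ₑ ≤ dualNorm ψ := le_iSup₂ (f := fun (w : Ctaub sU T) (_ : supNorm w ≤ 1) =>
      ‖ψ w‖ₑ) v h1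
    have h3 : ‖ψ v‖ ≤ (dualNorm ψ).toReal := by
      rw [← toReal_enorm]
      exact ENNReal.toReal_mono hψ h2
    have h4 : ‖ψ v‖ = (supNorm u)⁻¹ * ‖ψ u‖ := by
      rw [hv, map_smul, norm_smul, norm_inv, RCLike.norm_ofReal, abs_of_pos h0]
    rw [h4, inv_mul_le_iff₀ h0, mul_comm] at h3
    exact h3

variable [IsScalarTower ℝ 𝕜 X]

/-- The norm can be tested on `τ`-continuous functionals of norm at most one, for which the Pettis
identity reduces the bound to a scalar integral. -/
theorem exists_norm_inputMap_le (hX : sX.IsSeqComplete) (hS : IsLocallyBiContinuous sX S)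
    (hB : ∀ M : Set U, Bornology.IsBounded M → @ContinuousOn U X sU.tau sX.tau B M)
    (hT : 0 < T) : ∃ K : ℝ, 0 ≤ K ∧ ∀ u : Ctaub sU T, ‖inputMap sX S B u‖ ≤ K * supNorm u := by
  obtain ⟨K, hK0, hK⟩ := exists_norm_input_integrand_le hS B T
  refine ⟨K * T, by positivity, fun u => (sX.norming _).2 ?_⟩
  rintro _ ⟨φ, h1, h2, rfl⟩
  rw [(isPettisIntegral_inputMap hX hS hB hT u φ h1).2]
  refine (norm_integral_le_of_norm_le_const (C := K * supNorm u)
    (ae_of_all _ fun t => ?_)).trans_eq (by rw [lebesgueIcc_real_univ hT.le]; ring)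
  exact (h2 _).trans ((hK (reflect T t) _).trans
    (mul_le_mul_of_nonneg_left (norm_le_supNorm u t) hK0))

/-- The cost bound confines `x(T)` to a norm ball independent of the seminorm chosen, so
`τ`-smallness of `x(T)` makes `φ (x(T))` small. -/
theorem CostUniformApproxNullControllable.finalStateObservable (hX : sX.IsSeqComplete)
    (hXs : sX.IsCSequential) (hS : IsLocallyBiContinuous sX S)
    (hB : ∀ M : Set U, Bornology.IsBounded M → @ContinuousOn U X sU.tau sX.tau B M)
    (hT : 0 < T) (h : CostUniformApproxNullControllable sX sU T S B) :
    FinalStateObservable sX sU T S B := by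
  obtain ⟨C, hC0, hC⟩ := h
  obtain ⟨K, hK0, hK⟩ := exists_norm_inputMap_le hX hS hB hT
  -- The summand `1` keeps the constant nonzero, since `0 * ⊤ = 0` in `ℝ≥0∞`.
  refine ⟨C.toNNReal + 1, fun φ hφ => ?_⟩
  let ψ : Ctaub sU T →ₗ[𝕜] 𝕜 := (φ : X →ₗ[𝕜] 𝕜) ∘ₗ inputMapₗ hX hS hB hT
  change _ ≤ _ * dualNorm ψ
  by_cases hψ : dualNorm ψ = ⊤
  · rw [hψ, ENNReal.mul_top (by simp)]
    exact le_top
  set d := (dualNorm ψ).toReal with hd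
  have hd0 : 0 ≤ d := ENNReal.toReal_nonneg
  have key : ‖dualOp (S T) φ‖ ≤ C * d := by
    refine ContinuousLinearMap.opNorm_le_bound _ (by positivity) fun x => ?_
    refine le_of_forall_pos_le_add fun ε hε => ?_
    have h1 := sX.eventually_tau_lt (continuous_gamma_norm_circDual hXs hφ)
      (‖S T x‖ + K * (C * ‖x‖)) ε hε
    obtain ⟨p, hp, hpV⟩ := sX.exists_seminorm_ball_subset h1
    -- Any tolerance below `1` puts `x(T)` in the open unit ball of `p`.
    obtain ⟨u, hu, hpu⟩ := hC x (1 / 2) (by norm_num) p hp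
    rw [mildSolution_final] at hpu
    have h2 : ‖φ (S T x + inputMap sX S B u)‖ < ε :=
      hpV _ (by linarith) ((norm_add_le _ _).trans
        (add_le_add le_rfl ((hK u).trans (mul_le_mul_of_nonneg_left hu hK0))))
    have h3 : ‖φ (inputMap sX S B u)‖ ≤ d * (C * ‖x‖) :=
      (norm_le_dualNorm_mul_supNorm ψ hψ u).trans (mul_le_mul_of_nonneg_left hu hd0)
    have h4 : φ (S T x) = φ (S T x + inputMap sX S B u) - φ (inputMap sX S B u) := by
      rw [map_add, add_sub_cancel_right]
    change ‖φ (S T x)‖ ≤ _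
    rw [h4]
    refine (norm_sub_le _ _).trans ?_
    linarith
  have h5 : ‖dualOp (S T) φ‖ₑ ≤ ENNReal.ofReal (C * d) := by
    rw [← ofReal_norm]
    exact ENNReal.ofReal_le_ofReal key
  refine h5.trans ?_
  rw [ENNReal.ofReal_mul hC0, hd, ENNReal.ofReal_toReal hψ]
  gcongr
  rw [ENNReal.coe_add]
  exact le_self_add

/-- If no control of cost `r = C ‖x₀‖` works, separation yields `f ∈ (X, τ)'` with `re f (S_T x₀) >
-s`, while `|f| ≤ -s` on the reachable set. Observability then gives `|f (S_T x₀)| ≤ -s`, a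
contradiction. -/
theorem FinalStateObservable.costUniformApproxNullControllable (hX : sX.IsSeqComplete)
    (hS : IsLocallyBiContinuous sX S)
    (hB : ∀ M : Set U, Bornology.IsBounded M → @ContinuousOn U X sU.tau sX.tau B M)
    (hT : 0 < T) (h : FinalStateObservable sX sU T S B) :
    CostUniformApproxNullControllable sX sU T S B := by
  obtain ⟨C, hC⟩ := h
  refine ⟨C, C.2, fun x₀ ε hε p hp => ?_⟩
  by_contra! hcon
  let L : Ctaub sU T →ₗ[𝕜] X := inputMapₗ hX hS hB hT
  set r : ℝ := C * ‖x₀‖ with hr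
  have hr0 : 0 ≤ r := by positivity
  have hconv : Convex ℝ (L '' {u | supNorm u ≤ r}) := by
    rintro _ ⟨u, hu, rfl⟩ _ ⟨v, hv, rfl⟩ a b ha hb hab
    refine ⟨(a : 𝕜) • u + (b : 𝕜) • v, ?_, ?_⟩
    · refine supNorm_le hr0 fun t => (norm_add_le _ _).trans ?_
      simp only [Submodule.coe_smul, Pi.smul_apply, norm_smul, RCLike.norm_ofReal,
        abs_of_nonneg ha, abs_of_nonneg hb]
      have h1 := (norm_le_supNorm u t).trans hu
      have h2 := (norm_le_supNorm v t).trans hv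
      calc a * ‖u.1 t‖ + b * ‖v.1 t‖ ≤ a * r + b * r := by gcongr
        _ = r := by rw [← add_mul, hab, one_mul]
    · rw [map_add, map_smul, map_smul, ← algebraMap_smul 𝕜 a, ← algebraMap_smul 𝕜 b]
  have hdisj : Disjoint (p.ball (-(S T x₀)) ε) (L '' {u | supNorm u ≤ r}) := by
    rw [disjoint_left]
    rintro _ hz ⟨u, hu, rfl⟩
    rw [Seminorm.mem_ball, sub_neg_eq_add, add_comm] at hz
    have := hcon u hu
    rw [mildSolution_final] at this
    exact absurd hz this.not_gt
  obtain ⟨f, hf, s, hs1, hs2⟩ : ∃ f : X →ₗ[𝕜] 𝕜, Continuous[sX.tau, _] f ∧ ∃ s : ℝ,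
      (∀ a ∈ p.ball (-(S T x₀)) ε, RCLike.re (f a) < s) ∧
        ∀ b ∈ L '' {u | supNorm u ≤ r}, s ≤ RCLike.re (f b) := by
    let _ := sX.tau
    have _ := sX.isTopologicalAddGroup
    have _ := sX.continuousSMul
    obtain ⟨f, s, h1, h2⟩ := RCLike.geometric_hahn_banach_open (𝕜 := 𝕜)
      (p.convex_ball (-(S T x₀)) ε)
      (isOpen_lt (hp.comp (continuous_id.sub continuous_const)) continuous_const) hconv hdisj
    exact ⟨f, f.2, s, h1, h2⟩
  have h0 : RCLike.re (f (-(S T x₀))) < s := hs1 _ (by simpa [Seminorm.mem_ball] using hε)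
  -- The reachable set is balanced: a unimodular factor turns the bound on the real part into one on
  -- the modulus.
  have hball : ∀ u : Ctaub sU T, supNorm u ≤ r → ‖f (L u)‖ ≤ -s := by
    intro u hu
    obtain ⟨c, hc, hcf⟩ := RCLike.exists_norm_eq_mul_self (f (L u))
    have h1 := hs2 _ ⟨(-c) • u, by
      change supNorm _ ≤ r; rwa [supNorm_smul, norm_neg, hc, one_mul], rfl⟩
    rw [map_smul, map_smul, smul_eq_mul, neg_mul, ← hcf, map_neg, RCLike.ofReal_re] at h1
    linarith
  have hs0 : 0 ≤ -s := (norm_nonneg _).trans (hball 0 (by simpa [supNorm] using hr0))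
  let φ : StrongDual 𝕜 X := ⟨f, sX.continuous_of_continuous_tau hf⟩
  have h1 : ‖φ (S T x₀)‖ₑ ≤ ENNReal.ofReal (-s) := by
    calc ‖φ (S T x₀)‖ₑ ≤ ‖dualOp (S T) φ‖ₑ * ‖x₀‖ₑ :=
          (dualOp (S T) φ).le_opENorm x₀
      _ ≤ C * dualNorm (fun u : Ctaub sU T => φ (inputMap sX S B u)) * ‖x₀‖ₑ := by
          gcongr
          exact hC φ (sX.ofTau_mem_circDual hf)
      _ = (C * ‖x₀‖ₑ) * dualNorm (fun u : Ctaub sU T => φ (inputMap sX S B u)) := by ring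
      _ ≤ ENNReal.ofReal (-s) := by
          simp only [dualNorm, ENNReal.mul_iSup]
          refine iSup₂_le fun u hu => ?_
          -- The factor `C ‖x₀‖ = r` is absorbed by rescaling the unit-ball control to norm at most
          -- `r`.
          have h2 := hball ((r : 𝕜) • u) (by
            rw [supNorm_smul, RCLike.norm_ofReal, abs_of_nonneg hr0]
            exact mul_le_of_le_one_right hr0 hu)
          rw [map_smul, map_smul, norm_smul, RCLike.norm_ofReal, abs_of_nonneg hr0] at h2
          have h3 := ENNReal.ofReal_le_ofReal h2
          rw [ENNReal.ofReal_mul hr0, hr, ENNReal.ofReal_mul C.coe_nonneg, ofReal_norm,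
            ofReal_norm] at h3
          rw [ENNReal.ofReal_coe_nnreal] at h3
          exact h3
  rw [← ofReal_norm, ENNReal.ofReal_le_ofReal_iff hs0] at h1
  have h2 : RCLike.re (f (S T x₀)) ≤ -s := (RCLike.re_le_norm _).trans h1
  rw [map_neg, map_neg] at h0
  linarith

end

/-! ### Norm topology on `U`: the dual norm as a semivariation -/

section

/-- Radial retraction onto the closed unit ball. -/
def radialTruncation (𝕜 : Type*) {U : Type*} [RCLike 𝕜] [NormedAddCommGroup U] [NormedSpace 𝕜 U]
    (v : U) : U := (((max 1 ‖v‖)⁻¹ : ℝ) : 𝕜) • v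

section Truncation

variable {𝕜 U : Type*} [RCLike 𝕜] [NormedAddCommGroup U] [NormedSpace 𝕜 U]

theorem continuous_radialTruncation : Continuous (radialTruncation 𝕜 (U := U)) := by
  have h : Continuous fun v : U => (max 1 ‖v‖)⁻¹ :=
    (continuous_const.max continuous_norm).inv₀ fun v =>
      (lt_of_lt_of_le one_pos (le_max_left 1 ‖v‖)).ne'
  exact (RCLike.continuous_ofReal.comp h).smul continuous_id

theorem norm_radialTruncation_le (v : U) : ‖radialTruncation 𝕜 v‖ ≤ 1 := by
  have h : 0 < max 1 ‖v‖ := lt_of_lt_of_le one_pos (le_max_left _ _)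
  rw [radialTruncation, norm_smul, RCLike.norm_ofReal, abs_of_pos (inv_pos.2 h),
    inv_mul_le_iff₀ h, mul_one]
  exact le_max_right _ _

/-- Truncating `v` outside the unit ball moves it by `‖v‖ - 1 ≤ ‖v‖ - ‖w‖ ≤ ‖w - v‖`. -/
theorem norm_sub_radialTruncation_le {w : U} (hw : ‖w‖ ≤ 1) (v : U) :
    ‖w - radialTruncation 𝕜 v‖ ≤ 2 * ‖w - v‖ := by
  have h1 : ‖v - radialTruncation 𝕜 v‖ ≤ ‖w - v‖ := by
    rcases le_or_gt ‖v‖ 1 with hv | hv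
    · simp [radialTruncation, max_eq_left hv]
    · have h0 : 0 < ‖v‖ := one_pos.trans hv
      have h2 : v - radialTruncation 𝕜 v = ((1 - ‖v‖⁻¹ : ℝ) : 𝕜) • v := by
        rw [radialTruncation, max_eq_right hv.le]
        push_cast
        rw [sub_smul, one_smul]
      have h3 : 0 ≤ 1 - ‖v‖⁻¹ := sub_nonneg.2 (inv_le_one_of_one_le₀ hv.le)
      rw [h2, norm_smul, RCLike.norm_ofReal, abs_of_nonneg h3, sub_mul, one_mul,
        inv_mul_cancel₀ h0.ne']
      have h4 := norm_sub_norm_le v w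
      rw [norm_sub_rev v w] at h4
      linarith
  have h2 := norm_sub_le_norm_sub_add_norm_sub w v (radialTruncation 𝕜 v)
  linarith

end Truncation

section StepFunction

variable {Ω U : Type*} [NormedAddCommGroup U] {n : ℕ}

/-- The step function with value `u i` on `N i`, for disjoint sets `N i`. -/
def stepFunction (N : Fin n → Set Ω) (u : Fin n → U) (t : Ω) : U :=
  ∑ i, (N i).indicator (fun _ => u i) t

theorem stepFunction_apply {N : Fin n → Set Ω} (hd : Pairwise fun i j => Disjoint (N i) (N j))
    (u : Fin n → U) {t : Ω} {i : Fin n} (ht : t ∈ N i) : stepFunction N u t = u i := by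
  rw [stepFunction, Finset.sum_eq_single i, indicator_of_mem ht]
  · intro j _ hj
    exact indicator_of_notMem (fun h => disjoint_left.1 (hd hj) h ht) _
  · simp

theorem norm_stepFunction_le {N : Fin n → Set Ω} (hd : Pairwise fun i j => Disjoint (N i) (N j))
    (hN : ⋃ i, N i = univ) {u : Fin n → U} (hu : ∀ i, ‖u i‖ ≤ 1) (t : Ω) :
    ‖stepFunction N u t‖ ≤ 1 := by
  obtain ⟨i, hi⟩ := mem_iUnion.1 (hN.symm ▸ mem_univ t : t ∈ ⋃ i, N i)
  rw [stepFunction_apply hd u hi]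
  exact hu i

theorem stronglyMeasurable_stepFunction [MeasurableSpace Ω] {N : Fin n → Set Ω}
    (hN : ∀ i, MeasurableSet (N i)) (u : Fin n → U) : StronglyMeasurable (stepFunction N u) := by
  unfold stepFunction
  exact Finset.stronglyMeasurable_fun_sum _ fun i _ => stronglyMeasurable_const.indicator (hN i)

/-- A simple function is a step function. -/
theorem exists_eq_stepFunction [MeasurableSpace Ω] (F : SimpleFunc Ω U) :
    ∃ (n : ℕ) (N : Fin n → Set Ω) (u : Fin n → U), (∀ i, MeasurableSet (N i)) ∧
      (Pairwise fun i j => Disjoint (N i) (N j)) ∧ ⋃ i, N i = univ ∧ (∀ i, u i ∈ range F) ∧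
      stepFunction N u = F := by
  let e := F.range.equivFin
  let u : Fin F.range.card → U := fun i => (e.symm i : U)
  have hd : Pairwise fun i j => Disjoint (F ⁻¹' {u i}) (F ⁻¹' {u j}) := by
    intro i j hij
    refine disjoint_left.2 fun t h1 h2 => hij ?_
    have h3 : u i = u j := (mem_singleton_iff.1 h1).symm.trans (mem_singleton_iff.1 h2)
    exact e.symm.injective (Subtype.ext h3)
  have hmem : ∀ t, ∃ i, t ∈ F ⁻¹' {u i} := fun t =>
    ⟨e ⟨F t, F.mem_range_self t⟩, by simp [u]⟩
  refine ⟨_, fun i => F ⁻¹' {u i}, u, fun i => F.measurableSet_fiber _, hd,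
    eq_univ_of_forall fun t => mem_iUnion.2 (hmem t),
    fun i => SimpleFunc.mem_range.1 (e.symm i).2, ?_⟩
  ext t
  obtain ⟨i, hi⟩ := hmem t
  rw [stepFunction_apply hd u hi]
  exact (mem_singleton_iff.1 hi).symm

end StepFunction

variable {𝕜 : Type*} [RCLike 𝕜]
  {X : Type*} [NormedAddCommGroup X] [NormedSpace 𝕜 X] [Module ℝ X]
  {U : Type*} [NormedAddCommGroup U] [NormedSpace 𝕜 U]
  {sX : SaksSpace 𝕜 X} {S : ℝ → X →L[𝕜] X} {B : U →L[𝕜] X} {T : ℝ} {φ : StrongDual 𝕜 X}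

/-- The observation along a continuous input is continuous. -/
theorem continuous_observation (hS : IsLocallyBiContinuous sX S) (B : U →L[𝕜] X)
    (hφ : φ ∈ sX.circDual) {v : Icc (0 : ℝ) T → U} (hv : Continuous v) :
    Continuous fun t : Icc (0 : ℝ) T => φ (S t (B (v t))) := by
  obtain ⟨C, hC⟩ := (isCompact_range hv).isBounded.exists_norm_le
  have hC' : ∀ t, ‖v t‖ ≤ C := fun t => hC _ (mem_range_self t)
  obtain ⟨K, hK0, hK⟩ := exists_norm_input_integrand_le hS B T
  exact sX.continuous_circDual_comp
    (hS.continuous_orbit (continuous_le_rng sX.norm_le (B.continuous.comp hv))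
      (fun t => (B.le_opNorm _).trans (mul_le_mul_of_nonneg_left (hC' t) (norm_nonneg B)))
      continuous_id)
    (fun t => (hK t _).trans (mul_le_mul_of_nonneg_left (hC' t) hK0)) hφ

theorem integral_observation_stepFunction (hS : IsLocallyBiContinuous sX S) (B : U →L[𝕜] X)
    (hφ : φ ∈ sX.circDual) {n : ℕ} {N : Fin n → Set (Icc (0 : ℝ) T)}
    (hN : ∀ i, MeasurableSet (N i)) (u : Fin n → U) :
    Integrable (fun t : Icc (0 : ℝ) T => φ (S t (B (stepFunction N u t)))) (lebesgueIcc T) ∧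
      ∫ t, φ (S t (B (stepFunction N u t))) ∂lebesgueIcc T =
        ∑ i, obsMeasure T S B φ (N i) (u i) := by
  have h1 : (fun t : Icc (0 : ℝ) T => φ (S t (B (stepFunction N u t)))) =
      fun t => ∑ i, (N i).indicator (fun t : Icc (0 : ℝ) T => φ (S t (B (u i)))) t := by
    ext t
    rw [stepFunction, map_sum, map_sum, map_sum]
    refine Finset.sum_congr rfl fun i _ => ?_
    by_cases h : t ∈ N i <;> simp [h]
  have h2 : ∀ i, Integrable (fun t : Icc (0 : ℝ) T => φ (S t (B (u i)))) (lebesgueIcc T) :=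
    fun i => (continuous_observation hS B hφ continuous_const).integrable_of_hasCompactSupport
      (.of_compactSpace _)
  have h3 : ∀ i ∈ Finset.univ, Integrable
      (fun t => (N i).indicator (fun t : Icc (0 : ℝ) T => φ (S t (B (u i)))) t) (lebesgueIcc T) :=
    fun i _ => (h2 i).indicator (hN i)
  rw [h1]
  refine ⟨integrable_finsetSum _ h3, ?_⟩
  rw [integral_finsetSum _ h3]
  refine Finset.sum_congr rfl fun i _ => ?_
  rw [integral_indicator (hN i)]
  rfl

/-- The functions `v ∘ π n` take finitely many values in the unit ball, so they are competitors in
the semivariation; dominated convergence recovers `v`. -/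
theorem enorm_integral_observation_le_semivariation (hS : IsLocallyBiContinuous sX S)
    (B : U →L[𝕜] X) (hφ : φ ∈ sX.circDual) (hT : 0 < T) {v : Icc (0 : ℝ) T → U}
    (hv : Continuous v) (hv1 : ∀ t, ‖v t‖ ≤ 1) :
    ‖∫ t, φ (S t (B (v t))) ∂lebesgueIcc T‖ₑ ≤ semivariation (obsMeasure T S B φ) := by
  obtain ⟨K, hK0, hK⟩ := exists_norm_input_integrand_le hS B T
  let t₀ : Icc (0 : ℝ) T := ⟨0, le_rfl, hT.le⟩
  let π : ℕ → SimpleFunc (Icc (0 : ℝ) T) (Icc (0 : ℝ) T) :=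
    SimpleFunc.approxOn id measurable_id univ t₀ (mem_univ _)
  have hπ : ∀ t, Tendsto (fun n => π n t) atTop (𝓝 t) := fun t =>
    SimpleFunc.tendsto_approxOn measurable_id (mem_univ _) (by simp)
  have hstep : ∀ n,
      AEStronglyMeasurable (fun t : Icc (0 : ℝ) T => φ (S t (B (v (π n t))))) (lebesgueIcc T) ∧
      ‖∫ t, φ (S t (B (v (π n t)))) ∂lebesgueIcc T‖ₑ ≤ semivariation (obsMeasure T S B φ) := by
    intro n
    obtain ⟨m, N, u, hN, hd, hNu, hu, heq⟩ := exists_eq_stepFunction ((π n).map v)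
    obtain ⟨h1, h2⟩ := integral_observation_stepFunction hS B hφ hN u
    have hu1 : ∀ i, ‖u i‖ ≤ 1 := fun i => by
      obtain ⟨t, ht⟩ := hu i
      rw [← ht]; exact hv1 _
    rw [heq] at h1 h2
    refine ⟨h1.aestronglyMeasurable, ?_⟩
    change ‖∫ t, φ (S t (B ((π n).map v t))) ∂lebesgueIcc T‖ₑ ≤ _
    rw [h2]
    exact le_iSup_of_le m (le_iSup_of_le N (le_iSup_of_le u
      (le_iSup_of_le ⟨hN, hd, hNu⟩ (le_iSup_of_le hu1 le_rfl))))
  have hb : ∀ (t : Icc (0 : ℝ) T) (w : U), ‖w‖ ≤ 1 → ‖φ (S t (B w))‖ ≤ ‖φ‖ * K := fun t w hw =>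
    (φ.le_opNorm _).trans (mul_le_mul_of_nonneg_left
      ((hK t w).trans (mul_le_of_le_one_right hK0 hw)) (norm_nonneg φ))
  have hlim : Tendsto (fun n => ∫ t, φ (S t (B (v (π n t)))) ∂lebesgueIcc T) atTop
      (𝓝 (∫ t, φ (S t (B (v t))) ∂lebesgueIcc T)) := by
    refine tendsto_integral_of_dominated_convergence (fun _ => ‖φ‖ * K) (fun n => (hstep n).1)
      (integrable_const _) (fun n => ae_of_all _ fun t => hb _ _ (hv1 _))
      (ae_of_all _ fun t => ?_)
    have h1 : Continuous fun w : U => φ (S t (B w)) := by fun_prop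
    exact (h1.tendsto _).comp ((hv.tendsto t).comp (hπ t))
  exact le_of_tendsto hlim.enorm (Eventually.of_forall fun n => (hstep n).2)

/-- A step function in the unit ball can be replaced by a continuous function in the unit ball. -/
theorem exists_continuous_near_stepFunction [Module ℝ U] [IsScalarTower ℝ 𝕜 U]
    (hS : IsLocallyBiContinuous sX S) (B : U →L[𝕜] X) (hφ : φ ∈ sX.circDual) {n : ℕ}
    {N : Fin n → Set (Icc (0 : ℝ) T)} (hN : ∀ i, MeasurableSet (N i))
    (hd : Pairwise fun i j => Disjoint (N i) (N j)) (hNu : ⋃ i, N i = univ) {u : Fin n → U}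
    (hu : ∀ i, ‖u i‖ ≤ 1) {ε : ℝ} (hε : 0 < ε) :
    ∃ v : Icc (0 : ℝ) T → U, Continuous v ∧ (∀ t, ‖v t‖ ≤ 1) ∧
      ‖∑ i, obsMeasure T S B φ (N i) (u i)‖ ≤ ‖∫ t, φ (S t (B (v t))) ∂lebesgueIcc T‖ + ε := by
  let _ : NormedSpace ℝ U := realNormedSpace 𝕜 U
  obtain ⟨K, hK0, hK⟩ := exists_norm_input_integrand_le hS B T
  set w := stepFunction N u with hw
  have hw1 : ∀ t, ‖w t‖ ≤ 1 := norm_stepFunction_le hd hNu hu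
  have hwi : Integrable w (lebesgueIcc T) :=
    Integrable.of_bound (stronglyMeasurable_stepFunction hN u).aestronglyMeasurable 1
      (ae_of_all _ hw1)
  -- `‖φ‖ * K` bounds the observation functional, `2` is the loss from truncation, and `+ 1` ensures
  -- positivity.
  set D : ℝ := ‖φ‖ * K * 2 + 1 with hD
  have hD0 : 0 < D := by positivity
  -- Density of bounded continuous functions in `L¹` gives `g`; truncation then restores the bound
  -- `1` while keeping continuity.
  obtain ⟨g, hg, hgi⟩ := hwi.exists_boundedContinuous_integral_sub_le (div_pos hε hD0)
  have hvc : Continuous fun t => radialTruncation 𝕜 (g t) :=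
    continuous_radialTruncation.comp g.continuous
  refine ⟨fun t => radialTruncation 𝕜 (g t), hvc, fun t => norm_radialTruncation_le _, ?_⟩
  obtain ⟨h1, h2⟩ := integral_observation_stepFunction hS B hφ hN u
  have h3 : Integrable (fun t : Icc (0 : ℝ) T => φ (S t (B (radialTruncation 𝕜 (g t)))))
      (lebesgueIcc T) :=
    (continuous_observation hS B hφ hvc).integrable_of_hasCompactSupport (.of_compactSpace _)
  have h4 : ‖∫ t, φ (S t (B (w t))) ∂lebesgueIcc T -
      ∫ t, φ (S t (B (radialTruncation 𝕜 (g t)))) ∂lebesgueIcc T‖ ≤ ε := by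
    rw [← integral_sub h1 h3]
    refine (norm_integral_le_of_norm_le ((hwi.sub hgi).norm.const_mul (‖φ‖ * K * 2))
      (ae_of_all _ fun t => ?_)).trans ?_
    · rw [← map_sub, ← map_sub, ← map_sub]
      calc ‖φ (S t (B (w t - radialTruncation 𝕜 (g t))))‖
          ≤ ‖φ‖ * (K * ‖w t - radialTruncation 𝕜 (g t)‖) :=
            (φ.le_opNorm _).trans (mul_le_mul_of_nonneg_left (hK t _) (norm_nonneg φ))
        _ ≤ ‖φ‖ * (K * (2 * ‖w t - g t‖)) := by
            gcongr
            exact norm_sub_radialTruncation_le (hw1 t) _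
        _ = ‖φ‖ * K * 2 * ‖(w - g) t‖ := by rw [Pi.sub_apply]; ring
    · rw [integral_const_mul]
      calc ‖φ‖ * K * 2 * ∫ t, ‖(w - g) t‖ ∂lebesgueIcc T ≤ D * (ε / D) :=
            mul_le_mul (by linarith) hg (integral_nonneg fun t => norm_nonneg _) hD0.le
        _ = ε := mul_div_cancel₀ ε hD0.ne'
  rw [← h2]
  have h5 := norm_sub_norm_le (∫ t, φ (S t (B (w t))) ∂lebesgueIcc T)
    (∫ t, φ (S t (B (radialTruncation 𝕜 (g t)))) ∂lebesgueIcc T)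
  linarith

/-- If `τ_U` is the norm topology, the norm of `x° ∘ 𝓑^T` is the semivariation of the observation
measure. -/
theorem dualNorm_comp_inputMap_eq_semivariation [IsScalarTower ℝ 𝕜 X] [Module ℝ U]
    [IsScalarTower ℝ 𝕜 U] {sU : SaksSpace 𝕜 U} (hU : sU.tau = normTopology U)
    (hX : sX.IsSeqComplete) (hS : IsLocallyBiContinuous sX S)
    (hB : ∀ M : Set U, Bornology.IsBounded M → @ContinuousOn U X sU.tau sX.tau B M)
    (hT : 0 < T) (hφ : φ ∈ sX.circDual) :
    dualNorm (fun u : Ctaub sU T => φ (inputMap sX S B u)) =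
      semivariation (obsMeasure T S B φ) := by
  -- Time reversal turns `S (T - t)` into `S t`, and it preserves continuity and the sup norm of
  -- controls.
  have hspec : ∀ u : Ctaub sU T, φ (inputMap sX S B u) =
      ∫ t, φ (S t (B (u.1 (reflect T t)))) ∂lebesgueIcc T := fun u => by
    rw [(inputMap_spec hX hS hB hT u hφ).2,
      ← integral_reflect T fun t => φ (S t (B (u.1 (reflect T t))))]
    simp
  refine le_antisymm (iSup₂_le fun u hu => ?_) ?_
  · change ‖φ (inputMap sX S B u)‖ₑ ≤ _
    rw [hspec u]
    have huc : Continuous u.1 := by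
      have := u.2.1
      rwa [hU] at this
    exact enorm_integral_observation_le_semivariation hS B hφ hT
      (huc.comp (continuous_reflect T)) fun t => (norm_le_supNorm u _).trans hu
  · refine iSup_le fun n => iSup_le fun N => iSup_le fun u => iSup_le fun h => iSup_le fun hu => ?_
    refine ENNReal.le_of_forall_pos_le_add fun ε hε _ => ?_
    obtain ⟨v, hv, hv1, hle⟩ := exists_continuous_near_stepFunction hS B hφ h.1 h.2.1 h.2.2 hu
      (NNReal.coe_pos.2 hε)
    let y : Ctaub sU T := ⟨fun t => v (reflect T t), by
      rw [hU]; exact hv.comp (continuous_reflect T), 1, fun t => hv1 _⟩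
    have hy : φ (inputMap sX S B y) = ∫ t, φ (S t (B (v t))) ∂lebesgueIcc T := by
      rw [hspec]; simp [y]
    rw [← hy] at hle
    have h1 : ‖φ (inputMap sX S B y)‖ₑ ≤ dualNorm fun u : Ctaub sU T => φ (inputMap sX S B u) :=
      le_iSup₂ (f := fun (w : Ctaub sU T) (_ : supNorm w ≤ 1) => ‖φ (inputMap sX S B w)‖ₑ) y
        (supNorm_le zero_le_one fun t => hv1 _)
    refine le_trans ?_ (add_le_add_left h1 _)
    have h2 := ENNReal.ofReal_le_ofReal hle
    rw [ENNReal.ofReal_add (norm_nonneg _) ε.coe_nonneg, ofReal_norm, ofReal_norm] at h2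
    simpa using h2

end

end SaksControl

end

theorem mainTheorem1 {𝕜 : Type*} [RCLike 𝕜]
    {X : Type*} [NormedAddCommGroup X] [NormedSpace 𝕜 X] [Module ℝ X] [IsScalarTower ℝ 𝕜 X]
    {U : Type*} [NormedAddCommGroup U] [NormedSpace 𝕜 U] [Module ℝ U] [IsScalarTower ℝ 𝕜 U]
    (sX : SaksControl.SaksSpace 𝕜 X) (hXcomplete : sX.IsSeqComplete) (hXseq : sX.IsCSequential)
    (sU : SaksControl.SaksSpace 𝕜 U)
    (S : ℝ → X →L[𝕜] X) (hS : SaksControl.IsLocallyBiContinuous sX S)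
    (B : U →L[𝕜] X)
    (hB : ∀ M : Set U, Bornology.IsBounded M → @ContinuousOn U X sU.tau sX.tau B M)
    (T : ℝ) (hT : 0 < T) :
    -- the integrals defining `𝓑^T` exist, and `x° ∘ 𝓑^T ∈ (C_{τ,b}([0,T];U), γ_∞)'`
    (∀ u : SaksControl.Ctaub sU T,
      SaksControl.IsPettisIntegral sX (SaksControl.lebesgueIcc T)
        (fun t => S (T - t) (B (u.1 t))) (SaksControl.inputMap sX S B u)) ∧
    (∀ φ ∈ sX.circDual, ∃ ψ : SaksControl.Ctaub sU T →ₗ[𝕜] 𝕜,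
      Continuous[SaksControl.gammaInfty sU T, _] ψ ∧
        ∀ u, ψ u = φ (SaksControl.inputMap sX S B u)) ∧
    -- (a) is equivalent to (b)
    (SaksControl.CostUniformApproxNullControllable sX sU T S B ↔
      SaksControl.FinalStateObservable sX sU T S B) ∧
    -- if `τ_U` is the norm topology, each of (a) and (b) is equivalent to (c)
    (sU.tau = SaksControl.normTopology U →
      (SaksControl.CostUniformApproxNullControllable sX sU T S B ↔
        SaksControl.SemivariationObservable sX T S B) ∧
      (SaksControl.FinalStateObservable sX sU T S B ↔
        SaksControl.SemivariationObservable sX T S B)) := by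
  have hab : SaksControl.CostUniformApproxNullControllable sX sU T S B ↔
      SaksControl.FinalStateObservable sX sU T S B :=
    ⟨fun h => h.finalStateObservable hXcomplete hXseq hS hB hT,
      fun h => h.costUniformApproxNullControllable hXcomplete hS hB hT⟩
  refine ⟨SaksControl.isPettisIntegral_inputMap hXcomplete hS hB hT,
    fun φ hφ => SaksControl.exists_continuous_comp_inputMap hXcomplete hXseq hS hB hT hφ,
    hab, fun hU => ?_⟩
  have hbc : SaksControl.FinalStateObservable sX sU T S B ↔
      SaksControl.SemivariationObservable sX T S B := by
    refine exists_congr fun C => forall₂_congr fun φ hφ => ?_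
    rw [SaksControl.dualNorm_comp_inputMap_eq_semivariation hU hXcomplete hS hB hT hφ]
  exact ⟨hab.trans hbc, hbc⟩
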